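/- Let $n\ge 1$, and let $F$ be a Ferrers diagram of semiperimeter (number of rows plus number of columns) $n+1$. Label the rows and columns of $F$ by $0,1,\ldots,n$ along the south-east border from top right to bottom left, so that the top row has label $0$. Let $G(F)$ be the bipartite graph on $\{0,\ldots,n\}$ in which row $i$ and column $j$ are adjacent iff $F$ has a cell in row $i$ and column $j$. In the abelian sandpile model on $G(F)$ with sink $0$, let $\mathrm{Rec}(G(F))$ be the set of recurrent configurations $c=(c_1,\ldots,c_n)$, i.e. those obtained by adding grains to the maximally stable configuration and stabilizing, and let $\mathrm{Rec}^{\min}(G(F))$ be the set of those with minimal sum of heights. For $c\in\mathrm{Rec}(G(F))$ let $\mathrm{CanonTop}(c)=(U_0,V_1,U_1,V_2,\ldots)$, $U_0=\{0\}$, be the sequence of sets toppled when one topples the sink and then alternately all unstable column vertices ($V_1,V_2,\ldots$) and all unstable row vertices ($U_1,U_2,\ldots$). Let $\mathrm{minrec}(c)$ be the element of $\mathrm{Rec}^{\min}(G(F))$ with the same canonical toppling as $c$. An EW-tableau of shape $F$ is a $0/1$-filling $T$ of $F$ whose top row is all $1$s, in which every other row contains a $0$, and in which no four cells forming the corners of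 a rectangle have $0$s in two diagonally opposite corners and $1$s in the other two. For $c\in\mathrm{Rec}^{\min}(G(F))$ let $\phi_{CT}(c)$ be the filling of $F$ whose entry in row $i$ and column $j$ is $1$ if $i$ topples before $j$ in $\mathrm{CanonTop}(c)$, and $0$ if it topples after $j$. For $x\in \mathrm{Rec}(G(F))$ put $\psi(x)=\bigl(\phi_{CT}(\mathrm{minrec}(x)),\,x-\mathrm{minrec}(x)\bigr)$, and let $\mathrm{Rec}_{EW}(F)=\psi(\mathrm{Rec}(G(F)))$. For an EW-tableau $T$ of shape $F$, the permutation $\Psi(T)$ of $\{1,\ldots,n\}$ is obtained as follows. Change all entries of the top row to $0$. Then alternately (a) record the labels of all columns that contain only $0$s, in increasing order, and change their entries to $1$; (b) record the labels of all rows other than the top row that contain only $1$s, in decreasing order, and change their entries to $0$; continue until all of $1,\ldots,n$ are recorded. For a permutation $\pi$ of $\{1,\ldots,n\}$ let $D^{(0)},A^{(1)},D^{(1)},A^{(2)},\ldots$ with $D^{(0)}=\{0\}$ be its run decomposition: reading $\pi$ from left to right, it is cut into maximal blocks that are alternately increasing ($A^{(1)},A^{(2)},\ldots$) and decreasing ($D^{(1)},D^{(2)},\ldots$),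 where a letter continues the current increasing (decreasing) block iff it is larger (smaller) than the letter before it. A decorated permutation is a pair $(\pi,(a_1,\ldots,a_n))$ with integers $0\le a_i<|\{j>i : j\in A^{(k)},\ k\le \ell\}|$ if $i\in D^{(\ell)}$, and $0\le a_i<|\{j<i: j\in D^{(k)},\ k<\ell\}|$ if $i\in A^{(\ell)}$. It is canonical if moreover $a_i<\mu_i(\pi)$ for all $i$, where $\mu_i(\pi)=|\{j\in A^{(\ell)}: j>i\}|$ if $i\in D^{(\ell)}$, and $\mu_i(\pi)=|\{j\in D^{(\ell-1)}: j<i\}|$ if $i\in A^{(\ell)}$. Then, for every $n\ge1$: 1. for every Ferrers diagram $F$ of semiperimeter $n+1$, every EW-tableau $T$ of shape $F$ and every integer sequence $(a_1,\ldots,a_n)$, we have $(T,(a_1,\ldots,a_n))\in\mathrm{Rec}_{EW}(F)$ if and only if $(\Psi(T),(a_1,\ldots,a_n))$ is a canonical decorated permutation; 2. for every such $F$, the map $x\mapsto\bigl(\Psi(\phi_{CT}(\mathrm{minrec}(x))),\,x-\mathrm{minrec}(x)\bigr)$ is a bijection from $\mathrm{Rec}(G(F))$ to the set of canonical decorated permutations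 $(\pi,a)$ of $\{1,\ldots,n\}$ for which the set of descent bottoms of $\pi$ (letters immediately preceded by a greater letter) is the set of nonzero row labels of $F$; 3. consequently, this map, taken over all pairs $(F,x)$ with $F$ a Ferrers diagram of semiperimeter $n+1$ and $x\in\mathrm{Rec}(G(F))$, is a bijection onto the set of all canonical decorated permutations of $\{1,\ldots,n\}$. -/

import Mathlib

/-!
Ferrers graphs, EW-tableaux, the abelian sandpile model and decorated permutations.

Throughout, `n` is the size: the Ferrers diagrams considered have semiperimeter `n + 1`, and the
labels of their rows and columns are the elements `0, …, n` of `Fin (n + 1)`. Sequences indexed by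
the nonzero labels `1, …, n` are functions on `Fin n`, the index `i` standing for the label `i.succ`.
A Ferrers diagram is a `YoungDiagram`, whose cell `(i, j)` lies in the `i`-th row from the top and
the `j`-th column from the left, counted from `0`.
-/

namespace EW

open scoped Classical

noncomputable section

/-! ### Ferrers diagrams and Ferrers graphs -/

/-- Number of rows plus number of columns. -/
def semiperimeter (F : YoungDiagram) : ℕ := F.colLen 0 + F.rowLen 0

/-- The label of row `i`: the number of steps of the south-east border, read from the top right to
the bottom left, that precede the step of row `i` (`i` rows and `rowLen 0 - rowLen i` columns). -/
def rowLabel (F : YoungDiagram) (i : ℕ) : ℕ := i + (F.rowLen 0 - F.rowLen i)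

/-- The label of column `j`: the number of steps of the south-east border, read from the top right
to the bottom left, that precede the step of column `j` (the columns to the right of column `j`, and
the rows that meet column `j`). -/
def colLabel (F : YoungDiagram) (j : ℕ) : ℕ := (F.rowLen 0 - 1 - j) + F.colLen j

/-- The set of row labels. -/
def rows (n : ℕ) (F : YoungDiagram) : Finset (Fin (n + 1)) :=
  Finset.univ.filter fun v => ∃ i < F.colLen 0, (v : ℕ) = rowLabel F i

/-- The set of column labels. -/
def cols (n : ℕ) (F : YoungDiagram) : Finset (Fin (n + 1)) :=
  Finset.univ.filter fun v => ∃ j < F.rowLen 0, (v : ℕ) = colLabel F j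

/-- The Ferrers graph: a row and a column are joined when the diagram has a cell in both. -/
def ferrersGraph (n : ℕ) (F : YoungDiagram) : SimpleGraph (Fin (n + 1)) :=
  SimpleGraph.fromRel fun u v =>
    ∃ i j, (i, j) ∈ F ∧ (u : ℕ) = rowLabel F i ∧ (v : ℕ) = colLabel F j

/-! ### EW-tableaux -/

/-- A 0/1-filling of the cells of `F`. -/
abbrev Filling (F : YoungDiagram) : Type := {p : ℕ × ℕ // p ∈ F} → Fin 2

/-- EW-tableaux: the top row is all 1s, every other row contains a 0, and no four cells forming the
corners of a rectangle have 0s in two opposite corners and 1s in the other two. -/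
structure IsEWTableau (F : YoungDiagram) (T : Filling F) : Prop where
  top_row : ∀ j (h : (0, j) ∈ F), T ⟨(0, j), h⟩ = 1
  other_rows : ∀ i, 0 < i → i < F.colLen 0 → ∃ j, ∃ h : (i, j) ∈ F, T ⟨(i, j), h⟩ = 0
  rectangle : ∀ i i' j j' (h₁ : (i, j) ∈ F) (h₂ : (i', j') ∈ F) (h₃ : (i, j') ∈ F)
    (h₄ : (i', j) ∈ F), i ≠ i' → j ≠ j' →
    ¬ (T ⟨(i, j), h₁⟩ = 0 ∧ T ⟨(i', j'), h₂⟩ = 0 ∧ T ⟨(i, j'), h₃⟩ = 1 ∧ T ⟨(i', j), h₄⟩ = 1)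

/-! ### The abelian sandpile model on a graph with vertices `0, …, n` and sink `0` -/

/-- A configuration `(c_1, …, c_n)`. -/
abbrev Config (n : ℕ) : Type := Fin n → ℕ

variable {n : ℕ}

def deg (G : SimpleGraph (Fin (n + 1))) (v : Fin (n + 1)) : ℕ :=
  (Finset.univ.filter fun u => G.Adj v u).card

/-- The set of unstable (non-sink) vertices. -/
def unstable (G : SimpleGraph (Fin (n + 1))) (c : Config n) : Finset (Fin (n + 1)) :=
  Finset.univ.filter fun v => ∃ i : Fin n, v = i.succ ∧ deg G v ≤ c i

def IsStable (G : SimpleGraph (Fin (n + 1))) (c : Config n) : Prop :=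
  ∀ i : Fin n, c i < deg G i.succ

/-- The result of toppling every vertex of `S` once. It is applied only to the sink and to sets of
unstable vertices, so that the subtraction does not truncate. -/
def toppleSet (G : SimpleGraph (Fin (n + 1))) (S : Finset (Fin (n + 1))) (c : Config n) :
    Config n := fun i =>
  c i + (S.filter fun v => G.Adj v i.succ).card - if i.succ ∈ S then deg G i.succ else 0

/-- `c'` arises from `c` by toppling one unstable vertex. -/
def TopplesTo (G : SimpleGraph (Fin (n + 1))) (c c' : Config n) : Prop :=
  ∃ v ∈ unstable G c, c' = toppleSet G {v} c

/-- `c'` is a stabilization of `c`. -/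
def StabilizesTo (G : SimpleGraph (Fin (n + 1))) (c c' : Config n) : Prop :=
  Relation.ReflTransGen (TopplesTo G) c c' ∧ IsStable G c'

/-- The maximally stable configuration: every vertex is one grain short of toppling. -/
def maxStable (G : SimpleGraph (Fin (n + 1))) : Config n := fun i => deg G i.succ - 1

/-- The recurrent configurations: those obtained by adding grains to the maximally stable
configuration and stabilizing. -/
def recurrent (G : SimpleGraph (Fin (n + 1))) : Set (Config n) :=
  {c | ∃ a : Config n, StabilizesTo G (maxStable G + a) c}

/-- The recurrent configurations whose sum of heights is minimal. -/
def minRecurrent (G : SimpleGraph (Fin (n + 1))) : Set (Config n) :=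
  {c | c ∈ recurrent G ∧ ∀ c' ∈ recurrent G, ∑ i, c i ≤ ∑ i, c' i}

/-! ### Canonical toppling -/

/-- The vertices toppled in stage `k + 1` of the canonical toppling when the heights are `c`: all
unstable column vertices if `k + 1` is odd, all unstable row vertices if `k + 1` is even. -/
def nextBlock (F : YoungDiagram) (k : ℕ) (c : Config n) : Finset (Fin (n + 1)) :=
  unstable (ferrersGraph n F) c ∩ if Even k then cols n F else rows n F

/-- The heights after stage `k` of the canonical toppling of `c`; in stage `0` the sink topples. -/
def canonState (F : YoungDiagram) (c : Config n) : ℕ → Config n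
  | 0 => toppleSet (ferrersGraph n F) {0} c
  | k + 1 => toppleSet (ferrersGraph n F) (nextBlock F k (canonState F c k)) (canonState F c k)

/-- The canonical toppling `(U_0, V_1, U_1, V_2, …)` of `c`, continued by empty sets. -/
def canonTop (F : YoungDiagram) (c : Config n) : ℕ → Finset (Fin (n + 1))
  | 0 => {0}
  | k + 1 => nextBlock F k (canonState F c k)

/-- The minimal recurrent configuration with the same canonical toppling as `x`. -/
def minrec (F : YoungDiagram) (x : Config n) : Config n :=
  Classical.epsilon fun c => c ∈ minRecurrent (ferrersGraph n F) ∧ canonTop F c = canonTop F x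

/-- The filling with a 1 in the cells whose row topples before their column in the canonical
toppling of `c`, and a 0 in those whose row topples after their column. -/
def phiCT (F : YoungDiagram) (c : Config n) : Filling F := fun p =>
  if ∃ k l, k < l ∧ ∃ u ∈ canonTop F c k, ∃ v ∈ canonTop F c l,
      (u : ℕ) = rowLabel F p.1.1 ∧ (v : ℕ) = colLabel F p.1.2 then 1 else 0

/-- The map `ψ` from recurrent configurations to decorated EW-tableaux. The decorations are taken in
`ℤ`, so that the difference is the true one. -/
def psi (F : YoungDiagram) (x : Config n) : Filling F × (Fin n → ℤ) :=
  (phiCT F (minrec F x), fun i => (x i : ℤ) - (minrec F x i : ℤ))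

/-- The image of the recurrent configurations under `ψ`. -/
def recEW (n : ℕ) (F : YoungDiagram) : Set (Filling F × (Fin n → ℤ)) :=
  psi F '' recurrent (ferrersGraph n F)

/-! ### The permutation of an EW-tableau -/

/-- The labels recorded in step `k + 1` when the current filling is `T`: the columns of only 0s if
`k + 1` is odd, the rows (other than the top row) of only 1s if `k + 1` is even. -/
def nextRecord (n : ℕ) (F : YoungDiagram) (k : ℕ) (T : Filling F) : Finset (Fin (n + 1)) :=
  Finset.univ.filter fun v =>
    if Even k then
      ∃ j < F.rowLen 0, (v : ℕ) = colLabel F j ∧ ∀ p, p.1.2 = j → T p = 0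
    else
      ∃ i < F.colLen 0, 0 < i ∧ (v : ℕ) = rowLabel F i ∧ ∀ p, p.1.1 = i → T p = 1

/-- The current filling after step `k`, starting from `T`. In step `0` the top row is recorded and
its entries are changed to 0; afterwards the entries of the recorded columns are changed to 1 (odd
steps) and those of the recorded rows to 0 (even steps). -/
def tabState (n : ℕ) (F : YoungDiagram) (T : Filling F) : ℕ → Filling F
  | 0 => fun p => if p.1.1 = 0 then 0 else T p
  | k + 1 => fun p =>
      if Even k then
        if ∃ v ∈ nextRecord n F k (tabState n F T k), (v : ℕ) = colLabel F p.1.2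
          then 1 else tabState n F T k p
      else
        if ∃ v ∈ nextRecord n F k (tabState n F T k), (v : ℕ) = rowLabel F p.1.1
          then 0 else tabState n F T k p

/-- The sequence of recorded sets of labels, continued by empty sets. -/
def tabCanonTop (n : ℕ) (F : YoungDiagram) (T : Filling F) : ℕ → Finset (Fin (n + 1))
  | 0 => {0}
  | k + 1 => nextRecord n F k (tabState n F T k)

/-- `Ψ(T)`, as a word: the recorded sets after the initial `{0}`, one after the other, listed
alternately increasingly and decreasingly. (There are at most `n` nonempty ones.) -/
def Psi (n : ℕ) (F : YoungDiagram) (T : Filling F) : List (Fin (n + 1)) :=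
  (List.range n).flatMap fun k =>
    if Even k then (tabCanonTop n F T (k + 1)).sort (· ≤ ·)
    else (tabCanonTop n F T (k + 1)).sort (· ≥ ·)

/-! ### Decorated permutations -/

/-- `w` is a permutation of the letters `1, …, n`, written as a word. -/
def IsPermutation (w : List (Fin (n + 1))) : Prop :=
  w.Perm ((List.finRange n).map Fin.succ)

/-- The letters of `w` that are preceded by a greater one. -/
def descentBottoms (w : List (Fin (n + 1))) : Finset (Fin (n + 1)) :=
  Finset.univ.filter fun v => ∃ u, v < u ∧ [u, v] <:+: w

/-- The index of the block of the run decomposition that contains position `p` of the word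
`0, w_1, w_2, …`. Blocks of odd index are increasing, those of even index are decreasing, each block
is extended as long as possible, and the initial letter `0` is the block of index `0`. -/
def runIndex (w : List (Fin (n + 1))) : ℕ → ℕ
  | 0 => 0
  | p + 1 =>
    if (if Even (runIndex w p) then (0 :: w).getD (p + 1) 0 < (0 :: w).getD p 0
        else (0 :: w).getD p 0 < (0 :: w).getD (p + 1) 0)
      then runIndex w p else runIndex w p + 1

/-- The set of letters of the block of index `m` of the run decomposition. -/
def runBlock (w : List (Fin (n + 1))) (m : ℕ) : Finset (Fin (n + 1)) :=
  ((Finset.range (w.length + 1)).filter fun p => runIndex w p = m).image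
    fun p => (0 :: w).getD p 0

/-- The blocks `D^(0) = {0}, D^(1), D^(2), …` of the run decomposition. -/
def D (w : List (Fin (n + 1))) (l : ℕ) : Finset (Fin (n + 1)) := runBlock w (2 * l)

/-- The blocks `A^(1), A^(2), …` of the run decomposition; there is none of index `0`. -/
def A (w : List (Fin (n + 1))) : ℕ → Finset (Fin (n + 1))
  | 0 => ∅
  | l + 1 => runBlock w (2 * l + 1)

/-- `(w, a)` is a (stable) decorated permutation. -/
def IsDecoratedPermutation (w : List (Fin (n + 1))) (a : Fin n → ℤ) : Prop :=
  IsPermutation w ∧ ∀ (i : Fin n) (l : ℕ),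
    (i.succ ∈ D w l → 0 ≤ a i ∧
      a i < (Finset.univ.filter fun j => i.succ < j ∧ ∃ k ≤ l, j ∈ A w k).card) ∧
    (i.succ ∈ A w l → 0 ≤ a i ∧
      a i < (Finset.univ.filter fun j => j < i.succ ∧ ∃ k < l, j ∈ D w k).card)

/-- The statistic `μ_i(w)`: the number of larger letters of `A^(l)` if `i ∈ D^(l)`, and the number of
smaller letters of `D^(l - 1)` if `i ∈ A^(l)`. -/
def mu (w : List (Fin (n + 1))) (i : Fin (n + 1)) : ℕ :=
  (Finset.univ.filter fun j => ∃ l,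
    (i ∈ D w l ∧ j ∈ A w l ∧ i < j) ∨ (i ∈ A w l ∧ j ∈ D w (l - 1) ∧ j < i)).card

/-- `(w, a)` is a canonical decorated permutation. -/
def IsCanonical (w : List (Fin (n + 1))) (a : Fin n → ℤ) : Prop :=
  IsDecoratedPermutation w a ∧ ∀ i : Fin n, a i < mu w i.succ

/-- The canonical decorated permutation of a recurrent configuration on the Ferrers graph of `F`. -/
def toDecPerm (F : YoungDiagram) (x : Config n) : List (Fin (n + 1)) × (Fin n → ℤ) :=
  (Psi n F (psi F x).1, (psi F x).2)

end

end EW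

/-!
Why the theorem is true. Labelled along its border, a Ferrers diagram is the same thing as its set
`R` of row labels, which can be any set containing `0` and not `n` (`rows_injective`,
`exists_rows_eq`), and row `u` meets column `v` in a cell exactly when `u < v` (`adj_iff`).
Recurrent configurations, EW-tableaux and permutations are then all encoded by level functions
(`IsLevel`): functions `t` on the labels for which `0` is the only label of level `0`, the labels
of even level are the rows, and every other label has a neighbour on the level just before its
own.

*Configurations.* A stable configuration `x` has canonical toppling `({t = 0}, {t = 1}, …)`
exactly when `m i ≤ x i < m i + μ i` for all `i` (`Fits`), where `m i` is the number of neighbours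
of `i` on later levels (`lowHeight`) and `μ i > 0` is the number of its neighbours on the level
just before its own (`slack`). The recurrent configurations are those that fit some level function
(`exists_isLevel_of_mem_recurrent`, `mem_recurrent_of_fits`). The sum of the `m i` is the number
of edges not incident with the sink, whatever `t` is, so the minimal recurrent configurations are
the `m`'s, and `minrec x = m` (`minrec_eq`). Thus a recurrent configuration is a level function
`t` together with a decoration `0 ≤ a < μ`.

*Tableaux.* The filling `φ_CT(m)` compares the levels of the row and of the column of each cell
(`phiCT_eq`), and its recorded sets are again the levels (`mem_tabCanonTop`). The rectangle
condition makes the orientation of the edges of the graph given by an EW-tableau acyclic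
(`IsEWTableau.exists_source`), and the heights of this orientation form a level function, so every
EW-tableau is of this kind (`IsEWTableau.exists_isLevel`).

*Permutations.* Listing the levels alternately increasingly and decreasingly gives a permutation.
That every label has a neighbour on the previous level means precisely that no block continues the
preceding one, so the blocks of the run decomposition are the levels and the descent bottoms are
the nonzero rows (`Lists.step`, `Lists.mem_runBlock`, `Lists.descentBottoms_eq`); every
permutation arises in this way (`IsPermutation.exists_lists`). The statistic `μ` of the
permutation is the number `μ` above (`Lists.mu_eq`), and canonicity is the condition `0 ≤ a < μ`
(`Lists.isCanonical_iff`).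
-/

namespace EW

open scoped Classical

noncomputable section

variable {n : ℕ}

/-! ### Labels of rows and columns -/

section Labels

variable {F : YoungDiagram}

theorem rowLabel_lt_colLabel {i j : ℕ} (h : (i, j) ∈ F) : rowLabel F i < colLabel F j := by
  have h1 := YoungDiagram.mem_iff_lt_rowLen.1 h
  have h2 := YoungDiagram.mem_iff_lt_colLen.1 h
  have h3 := F.rowLen_anti 0 i (Nat.zero_le _)
  unfold rowLabel colLabel
  omega

theorem colLabel_lt_rowLabel {i j : ℕ} (hj : j < F.rowLen 0) (h : (i, j) ∉ F) :
    colLabel F j < rowLabel F i := by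
  have h1 := mt YoungDiagram.mem_iff_lt_rowLen.2 h
  have h2 := mt YoungDiagram.mem_iff_lt_colLen.2 h
  unfold rowLabel colLabel
  omega

theorem rowLabel_lt_rowLabel {i i' : ℕ} (h : i < i') : rowLabel F i < rowLabel F i' := by
  have h1 := F.rowLen_anti i i' h.le
  unfold rowLabel
  omega

theorem rowLabel_injective : Function.Injective (rowLabel F) :=
  StrictMono.injective fun _ _ h => rowLabel_lt_rowLabel h

theorem colLabel_inj {j j' : ℕ} (hj : j < F.rowLen 0) (hj' : j' < F.rowLen 0)
    (h : colLabel F j = colLabel F j') : j = j' := by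
  unfold colLabel at h
  rcases lt_trichotomy j j' with hl | hl | hl
  · have := F.colLen_anti j j' hl.le
    omega
  · exact hl
  · have := F.colLen_anti j' j hl.le
    omega

theorem rowLabel_zero : rowLabel F 0 = 0 := by simp [rowLabel]

theorem row_lt_of_mem {i j : ℕ} (h : (i, j) ∈ F) : i < F.colLen 0 :=
  YoungDiagram.mem_iff_lt_colLen.1 (F.up_left_mem le_rfl (Nat.zero_le j) h)

theorem col_lt_of_mem {i j : ℕ} (h : (i, j) ∈ F) : j < F.rowLen 0 :=
  YoungDiagram.mem_iff_lt_rowLen.1 (F.up_left_mem (Nat.zero_le i) le_rfl h)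

variable (hF : semiperimeter F = n + 1)
include hF

theorem colLen_pos (hn : 1 ≤ n) : 0 < F.colLen 0 ∧ 0 < F.rowLen 0 := by
  have h : 0 < F.colLen 0 ↔ 0 < F.rowLen 0 := by
    rw [← YoungDiagram.mem_iff_lt_colLen, ← YoungDiagram.mem_iff_lt_rowLen]
  unfold semiperimeter at hF
  omega

theorem rowLabel_le {i : ℕ} (hi : i < F.colLen 0) : rowLabel F i < n + 1 := by
  have h : 0 < F.rowLen i := YoungDiagram.mem_iff_lt_rowLen.1 (YoungDiagram.mem_iff_lt_colLen.2 hi)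
  unfold rowLabel
  unfold semiperimeter at hF
  omega

theorem colLabel_le {j : ℕ} (hj : j < F.rowLen 0) : colLabel F j < n + 1 := by
  have := F.colLen_anti 0 j (Nat.zero_le _)
  unfold colLabel
  unfold semiperimeter at hF
  omega

theorem card_rows : (rows n F).card = F.colLen 0 := by
  rw [← Finset.card_range (F.colLen 0)]
  refine (Finset.card_bij (fun i hi => ⟨rowLabel F i, rowLabel_le hF (Finset.mem_range.1 hi)⟩)
    ?_ ?_ ?_).symm
  · intro i hi
    simp only [rows, Finset.mem_filter, Finset.mem_univ, true_and]
    exact ⟨i, Finset.mem_range.1 hi, rfl⟩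
  · intro i _ i' _ h
    exact rowLabel_injective (Fin.mk.inj_iff.1 h)
  · intro v hv
    simp only [rows, Finset.mem_filter, Finset.mem_univ, true_and] at hv
    obtain ⟨i, hi, hv⟩ := hv
    exact ⟨i, Finset.mem_range.2 hi, Fin.ext hv.symm⟩

theorem card_cols : (cols n F).card = F.rowLen 0 := by
  rw [← Finset.card_range (F.rowLen 0)]
  refine (Finset.card_bij (fun i hi => ⟨colLabel F i, colLabel_le hF (Finset.mem_range.1 hi)⟩)
    ?_ ?_ ?_).symm
  · intro i hi
    simp only [cols, Finset.mem_filter, Finset.mem_univ, true_and]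
    exact ⟨i, Finset.mem_range.1 hi, rfl⟩
  · intro i hi i' hi' h
    exact colLabel_inj (Finset.mem_range.1 hi) (Finset.mem_range.1 hi') (Fin.mk.inj_iff.1 h)
  · intro v hv
    simp only [cols, Finset.mem_filter, Finset.mem_univ, true_and] at hv
    obtain ⟨i, hi, hv⟩ := hv
    exact ⟨i, Finset.mem_range.2 hi, Fin.ext hv.symm⟩

/-- Every step of the border belongs to exactly one row or column: a row label and a column label
differ, and there are `n + 1` of them altogether. -/
theorem cols_eq_compl : cols n F = (rows n F)ᶜ := by
  have hd : Disjoint (rows n F) (cols n F) := by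
    rw [Finset.disjoint_left]
    intro v hr hc
    simp only [rows, cols, Finset.mem_filter, Finset.mem_univ, true_and] at hr hc
    obtain ⟨i, _, hi⟩ := hr
    obtain ⟨j, hj, hj'⟩ := hc
    by_cases h : (i, j) ∈ F
    · have := rowLabel_lt_colLabel h
      omega
    · have := colLabel_lt_rowLabel hj h
      omega
  refine Finset.eq_of_subset_of_card_le ?_ ?_
  · intro v hv
    rw [Finset.mem_compl]
    exact fun h => Finset.disjoint_left.1 hd h hv
  · rw [Finset.card_compl, card_rows hF, card_cols hF, Fintype.card_fin, ← hF]
    unfold semiperimeter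
    omega

theorem mem_cols {v : Fin (n + 1)} : v ∈ cols n F ↔ v ∉ rows n F := by
  rw [cols_eq_compl hF, Finset.mem_compl]

theorem zero_mem_rows (hn : 1 ≤ n) : (0 : Fin (n + 1)) ∈ rows n F := by
  simp only [rows, Finset.mem_filter, Finset.mem_univ, true_and]
  exact ⟨0, (colLen_pos hF hn).1, by simp [rowLabel_zero]⟩

omit hF in
theorem exists_row {v : Fin (n + 1)} (hv : v ∈ rows n F) :
    ∃ i < F.colLen 0, (v : ℕ) = rowLabel F i := by
  simpa [rows] using hv

theorem exists_col {v : Fin (n + 1)} (hv : v ∉ rows n F) :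
    ∃ j < F.rowLen 0, (v : ℕ) = colLabel F j := by
  simpa [cols] using (mem_cols hF).2 hv

omit hF in
theorem rowLabel_mem {v : Fin (n + 1)} {i : ℕ} (hi : i < F.colLen 0) (hv : (v : ℕ) = rowLabel F i) :
    v ∈ rows n F := by
  simp only [rows, Finset.mem_filter, Finset.mem_univ, true_and]
  exact ⟨i, hi, hv⟩

theorem colLabel_not_mem {v : Fin (n + 1)} {j : ℕ} (hj : j < F.rowLen 0)
    (hv : (v : ℕ) = colLabel F j) : v ∉ rows n F := by
  rw [← mem_cols hF]
  simp only [cols, Finset.mem_filter, Finset.mem_univ, true_and]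
  exact ⟨j, hj, hv⟩

end Labels

/-- Adjacency in the Ferrers graph with set `R` of row labels: a row and a column meet in a cell
exactly when the row comes first on the border. -/
def FAdj (R : Finset (Fin (n + 1))) (u v : Fin (n + 1)) : Prop :=
  (u ∈ R ∧ v ∉ R ∧ u < v) ∨ (v ∈ R ∧ u ∉ R ∧ v < u)

theorem FAdj.symm {R : Finset (Fin (n + 1))} {u v : Fin (n + 1)} (h : FAdj R u v) : FAdj R v u :=
  Or.symm h

theorem fAdj_comm {R : Finset (Fin (n + 1))} {u v : Fin (n + 1)} : FAdj R u v ↔ FAdj R v u :=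
  ⟨FAdj.symm, FAdj.symm⟩

theorem FAdj.mem_iff {R : Finset (Fin (n + 1))} {u v : Fin (n + 1)} (h : FAdj R u v) :
    u ∈ R ↔ v ∉ R := by
  rcases h with ⟨h1, h2, _⟩ | ⟨h1, h2, _⟩ <;> simp [h1, h2]

theorem mem_iff_lt {F : YoungDiagram} {i j : ℕ} (hj : j < F.rowLen 0) :
    (i, j) ∈ F ↔ rowLabel F i < colLabel F j := by
  refine ⟨rowLabel_lt_colLabel, fun h => ?_⟩
  by_contra h'
  have := colLabel_lt_rowLabel hj h'
  omega

theorem adj_iff {F : YoungDiagram} (hF : semiperimeter F = n + 1) {u v : Fin (n + 1)} :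
    (ferrersGraph n F).Adj u v ↔ FAdj (rows n F) u v := by
  have key : ∀ u v : Fin (n + 1),
      (∃ i j, (i, j) ∈ F ∧ (u : ℕ) = rowLabel F i ∧ (v : ℕ) = colLabel F j) ↔
        (u ∈ rows n F ∧ v ∉ rows n F ∧ u < v) := by
    intro u v
    constructor
    · rintro ⟨i, j, h, hu, hv⟩
      refine ⟨rowLabel_mem (row_lt_of_mem h) hu, colLabel_not_mem hF (col_lt_of_mem h) hv, ?_⟩
      rw [Fin.lt_def, hu, hv]
      exact rowLabel_lt_colLabel h
    · rintro ⟨hu, hv, h⟩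
      obtain ⟨i, hi, hu⟩ := exists_row hu
      obtain ⟨j, hj, hv⟩ := exists_col hF hv
      refine ⟨i, j, (mem_iff_lt hj).2 ?_, hu, hv⟩
      rwa [← hu, ← hv]
  unfold ferrersGraph
  rw [SimpleGraph.fromRel_adj, key u v, key v u]
  unfold FAdj
  constructor
  · exact fun h => h.2
  · intro h
    refine ⟨?_, h⟩
    rintro rfl
    rcases h with h | h <;> exact lt_irrefl _ h.2.2

/-! ### Ferrers diagrams and their sets of row labels -/

/-- A Ferrers diagram is determined by the set of its row labels. -/
theorem rows_injective {F F' : YoungDiagram} (hF : semiperimeter F = n + 1)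
    (hF' : semiperimeter F' = n + 1) (h : rows n F = rows n F') : F = F' := by
  have hc : F.colLen 0 = F'.colLen 0 := by rw [← card_rows hF, ← card_rows hF', h]
  have hr : F.rowLen 0 = F'.rowLen 0 := by
    unfold semiperimeter at hF hF'
    omega
  have hl : ∀ i < F.colLen 0, rowLabel F i = rowLabel F' i := by
    let f : Fin (F.colLen 0) → Fin (n + 1) := fun i => ⟨rowLabel F i, rowLabel_le hF i.2⟩
    let f' : Fin (F.colLen 0) → Fin (n + 1) :=
      fun i => ⟨rowLabel F' i, rowLabel_le hF' (hc ▸ i.2)⟩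
    have e : f = f' := by
      rw [Finset.orderEmbOfFin_unique (f := f) (card_rows hF)
        (fun i => rowLabel_mem i.2 rfl) (fun _ _ h => rowLabel_lt_rowLabel h),
        Finset.orderEmbOfFin_unique (f := f') (card_rows hF)
        (fun i => h ▸ rowLabel_mem (hc ▸ i.2) rfl) (fun _ _ h => rowLabel_lt_rowLabel h)]
    intro i hi
    exact Fin.mk.inj_iff.1 (congrFun e ⟨i, hi⟩)
  have hrow : ∀ i < F.colLen 0, F.rowLen i = F'.rowLen i := by
    intro i hi
    have h1 := hl i hi
    have h2 := F.rowLen_anti 0 i (Nat.zero_le _)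
    have h3 := F'.rowLen_anti 0 i (Nat.zero_le _)
    unfold rowLabel at h1
    omega
  ext ⟨i, j⟩
  rw [YoungDiagram.mem_cells, YoungDiagram.mem_cells]
  constructor
  · intro hm
    rw [YoungDiagram.mem_iff_lt_rowLen, ← hrow i (row_lt_of_mem hm)]
    exact YoungDiagram.mem_iff_lt_rowLen.1 hm
  · intro hm
    rw [YoungDiagram.mem_iff_lt_rowLen, hrow i (hc ▸ row_lt_of_mem hm)]
    exact YoungDiagram.mem_iff_lt_rowLen.1 hm

/-- Every set of labels that contains `0` and not `n` is the set of row labels of a Ferrers diagram: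
the row labelled `r` has as many cells as there are labels greater than `r` outside the set. -/
theorem exists_rows_eq {R : Finset (Fin (n + 1))} (h0 : 0 ∈ R) (hlast : Fin.last n ∉ R) :
    ∃ F : YoungDiagram, semiperimeter F = n + 1 ∧ rows n F = R := by
  let e := R.orderEmbOfFin rfl
  let len : Fin (n + 1) → ℕ := fun r => (Finset.univ.filter fun v => v ∉ R ∧ r < v).card
  have len_anti : ∀ r s, r ≤ s → len s ≤ len r := by
    intro r s hrs
    refine Finset.card_le_card fun v hv => ?_
    simp only [Finset.mem_filter, Finset.mem_univ, true_and] at hv ⊢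
    exact ⟨hv.1, hrs.trans_lt hv.2⟩
  have len_pos : ∀ r ∈ R, 0 < len r := by
    intro r hr
    refine Finset.card_pos.2 ⟨Fin.last n, ?_⟩
    simp only [Finset.mem_filter, Finset.mem_univ, true_and]
    exact ⟨hlast, lt_of_le_of_ne (Fin.le_last r) fun h => hlast (h ▸ hr)⟩
  let F : YoungDiagram :=
    { cells := (Finset.range R.card ×ˢ Finset.range (n + 1)).filter fun p =>
        ∃ h : p.1 < R.card, p.2 < len (e ⟨p.1, h⟩)
      isLowerSet := by
        rintro ⟨i, j⟩ ⟨i', j'⟩ ⟨h1, h2⟩ h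
        simp only [Finset.coe_filter, Finset.mem_product, Finset.mem_range, Set.mem_ofPred_eq]
          at h h1 h2 ⊢
        obtain ⟨⟨h3, h4⟩, h5, h6⟩ := h
        exact ⟨⟨by omega, by omega⟩, by omega,
          h2.trans_lt (h6.trans_le (len_anti _ _ (e.monotone h1)))⟩ }
  have hmem : ∀ i j, (i, j) ∈ F ↔ ∃ h : i < R.card, j < len (e ⟨i, h⟩) := by
    intro i j
    rw [← YoungDiagram.mem_cells]
    simp only [F, Finset.mem_filter, Finset.mem_product, Finset.mem_range]
    constructor
    · exact fun h => h.2
    · rintro ⟨h, h'⟩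
      refine ⟨⟨h, h'.trans_le ?_⟩, h, h'⟩
      simpa using Finset.card_le_univ (Finset.univ.filter fun v => v ∉ R ∧ e ⟨i, h⟩ < v)
  have hcol : F.colLen 0 = R.card := by
    refine eq_of_forall_lt_iff fun i => ?_
    rw [← YoungDiagram.mem_iff_lt_colLen, hmem]
    exact ⟨fun h => h.1, fun h => ⟨h, len_pos _ (R.orderEmbOfFin_mem rfl _)⟩⟩
  have hrow : ∀ i (h : i < R.card), F.rowLen i = len (e ⟨i, h⟩) := by
    intro i h
    refine eq_of_forall_lt_iff fun j => ?_
    rw [← YoungDiagram.mem_iff_lt_rowLen, hmem]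
    exact ⟨fun h => h.2, fun h' => ⟨h, h'⟩⟩
  have hR : 0 < R.card := Finset.card_pos.2 ⟨0, h0⟩
  have he0 : e ⟨0, hR⟩ = 0 := by
    rw [Finset.orderEmbOfFin_zero rfl hR]
    exact le_antisymm (Finset.min'_le _ _ h0) (Fin.zero_le _)
  have hrow0 : F.rowLen 0 = Rᶜ.card := by
    rw [hrow 0 hR, he0]
    simp only [len]
    congr 1
    ext v
    simp only [Finset.mem_filter, Finset.mem_univ, true_and, Finset.mem_compl, and_iff_left_iff_imp]
    exact fun hv => Fin.pos_of_ne_zero fun h => hv (h ▸ h0)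
  have hF : semiperimeter F = n + 1 := by
    unfold semiperimeter
    rw [hcol, hrow0, Finset.card_add_card_compl, Fintype.card_fin]
  refine ⟨F, hF, ?_⟩
  -- The label of row `i` counts the rows above it and the columns that end above it, that is, all
  -- labels smaller than the `i`-th element of `R`.
  have hlab : ∀ i (h : i < R.card), rowLabel F i = e ⟨i, h⟩ := by
    intro i h
    have h1 : (R.filter fun v => v < e ⟨i, h⟩).card = i := by
      have : (R.filter fun v => v < e ⟨i, h⟩) = (Finset.univ.filter fun k => k < ⟨i, h⟩).map
          e.toEmbedding := by
        ext v
        simp only [Finset.mem_filter, Finset.mem_map, Finset.mem_univ, true_and]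
        constructor
        · rintro ⟨hv, hlt⟩
          have : v ∈ Set.range e := by rw [Finset.range_orderEmbOfFin]; exact hv
          obtain ⟨k, rfl⟩ := this
          exact ⟨k, e.lt_iff_lt.1 hlt, rfl⟩
        · rintro ⟨k, hk, rfl⟩
          exact ⟨R.orderEmbOfFin_mem rfl _, e.lt_iff_lt.2 hk⟩
      rw [this, Finset.card_map]
      have : (Finset.univ.filter fun k : Fin R.card => k < ⟨i, h⟩) = Finset.Iio ⟨i, h⟩ := by
        ext; simp
      rw [this, Fin.card_Iio]
    have h2 : (Finset.univ.filter fun v => v < e ⟨i, h⟩).card = (e ⟨i, h⟩ : ℕ) := by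
      have : (Finset.univ.filter fun v : Fin (n + 1) => v < e ⟨i, h⟩) = Finset.Iio (e ⟨i, h⟩) := by
        ext; simp
      rw [this, Fin.card_Iio]
    have h3 : (Finset.univ.filter fun v => v < e ⟨i, h⟩).card =
        (R.filter fun v => v < e ⟨i, h⟩).card + (Rᶜ.filter fun v => v < e ⟨i, h⟩).card := by
      rw [← Finset.card_union_of_disjoint (Finset.disjoint_filter_filter disjoint_compl_right),
        ← Finset.filter_union, Finset.union_compl]
    have h4 : Rᶜ.card = (Rᶜ.filter fun v => v < e ⟨i, h⟩).card + len (e ⟨i, h⟩) := by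
      rw [← Finset.card_filter_add_card_filter_not (fun v => v < e ⟨i, h⟩)]
      congr 2
      ext v
      simp only [Finset.mem_filter, Finset.mem_univ, true_and, Finset.mem_compl, not_lt]
      refine and_congr_right fun hv => ⟨fun h' => lt_of_le_of_ne h' fun h'' => hv ?_, le_of_lt⟩
      rw [← h'']
      exact R.orderEmbOfFin_mem rfl _
    unfold rowLabel
    rw [hrow0, hrow i h]
    omega
  ext v
  constructor
  · intro hv
    obtain ⟨i, hi, hv⟩ := exists_row hv
    rw [hcol] at hi
    rw [hlab i hi] at hv
    rw [Fin.ext hv]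
    exact R.orderEmbOfFin_mem rfl _
  · intro hv
    have : v ∈ Set.range e := by rw [Finset.range_orderEmbOfFin]; exact hv
    obtain ⟨k, rfl⟩ := this
    exact rowLabel_mem (hcol.symm ▸ k.2) (hlab k k.2).symm

/-! ### Level functions -/

/-- The number of neighbours of `v` that satisfy `p`. -/
def nb (R : Finset (Fin (n + 1))) (v : Fin (n + 1)) (p : Fin (n + 1) → Prop) : ℕ :=
  (Finset.univ.filter fun u => FAdj R u v ∧ p u).card

section Count

variable {R : Finset (Fin (n + 1))} {v : Fin (n + 1)} {p q r : Fin (n + 1) → Prop}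

theorem nb_mono (h : ∀ u, FAdj R u v → p u → q u) : nb R v p ≤ nb R v q := by
  refine Finset.card_le_card fun u hu => ?_
  simp only [Finset.mem_filter, Finset.mem_univ, true_and] at hu ⊢
  exact ⟨hu.1, h u hu.1 hu.2⟩

theorem nb_congr (h : ∀ u, FAdj R u v → (p u ↔ q u)) : nb R v p = nb R v q :=
  le_antisymm (nb_mono fun u hu => (h u hu).1) (nb_mono fun u hu => (h u hu).2)

theorem nb_add (h : ∀ u, FAdj R u v → (r u ↔ p u ∨ q u)) (hd : ∀ u, FAdj R u v → p u → ¬ q u) :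
    nb R v r = nb R v p + nb R v q := by
  unfold nb
  rw [← Finset.card_union_of_disjoint]
  · congr 1
    ext u
    simp only [Finset.mem_filter, Finset.mem_univ, true_and, Finset.mem_union]
    rw [← and_or_left]
    exact and_congr_right (h u)
  · rw [Finset.disjoint_left]
    intro u hu hu'
    simp only [Finset.mem_filter, Finset.mem_univ, true_and] at hu hu'
    exact hd u hu.1 hu.2 hu'.2

theorem nb_pos : 0 < nb R v p ↔ ∃ u, FAdj R u v ∧ p u := by
  unfold nb
  rw [Finset.card_pos]
  simp [Finset.Nonempty]

theorem nb_eq_zero (h : ∀ u, FAdj R u v → ¬ p u) : nb R v p = 0 := by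
  rw [← Nat.le_zero, ← not_lt, nb_pos]
  rintro ⟨u, hu, hp⟩
  exact h u hu hp

theorem nb_le : nb R v p ≤ n + 1 := by
  simpa [nb] using Finset.card_le_univ (Finset.univ.filter fun u => FAdj R u v ∧ p u)

end Count

/-- The functions `v ↦ k` recording the stage `k` at which `v` topples in a canonical toppling: only
`0` has level `0`, rows have even levels and columns odd ones, and every other vertex has a
neighbour on the level just before its own. -/
structure IsLevel (R : Finset (Fin (n + 1))) (t : Fin (n + 1) → ℕ) : Prop where
  zero : t 0 = 0
  even_iff : ∀ v, Even (t v) ↔ v ∈ R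
  prev : ∀ v ≠ 0, ∃ u, FAdj R u v ∧ t u + 1 = t v

/-- The number of neighbours on later levels. -/
def lowHeight (R : Finset (Fin (n + 1))) (t : Fin (n + 1) → ℕ) (i : Fin n) : ℕ :=
  nb R i.succ fun u => t i.succ < t u

/-- The number of neighbours on the level just before that of `v`. -/
def slack (R : Finset (Fin (n + 1))) (t : Fin (n + 1) → ℕ) (v : Fin (n + 1)) : ℕ :=
  nb R v fun u => t u + 1 = t v

/-- The heights for which vertex `i` becomes unstable at stage `t i` exactly. -/
def Fits (R : Finset (Fin (n + 1))) (t : Fin (n + 1) → ℕ) (x : Config n) : Prop :=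
  ∀ i, lowHeight R t i ≤ x i ∧ x i < lowHeight R t i + slack R t i.succ

namespace IsLevel

variable {R : Finset (Fin (n + 1))} {t : Fin (n + 1) → ℕ} (ht : IsLevel R t)
include ht

theorem eq_zero_iff {v : Fin (n + 1)} : t v = 0 ↔ v = 0 := by
  refine ⟨fun h => ?_, fun h => h ▸ ht.zero⟩
  by_contra hv
  obtain ⟨u, _, hu⟩ := ht.prev v hv
  omega

theorem even_of_adj {u v : Fin (n + 1)} (h : FAdj R u v) : Even (t u) ↔ ¬ Even (t v) := by
  rw [ht.even_iff, ht.even_iff]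
  exact h.mem_iff

theorem slack_pos (i : Fin n) : 0 < slack R t i.succ :=
  nb_pos.2 (ht.prev _ (Fin.succ_ne_zero i))

theorem fits_lowHeight : Fits R t (lowHeight R t) := fun i =>
  ⟨le_rfl, Nat.lt_add_of_pos_right (ht.slack_pos i)⟩

theorem exists_eq {v : Fin (n + 1)} {k : ℕ} (hk : k ≤ t v) : ∃ u, t u = k := by
  obtain ⟨d, hd⟩ := Nat.exists_eq_add_of_le hk
  induction d generalizing v with
  | zero => exact ⟨v, hd⟩
  | succ d ih =>
    have hv : v ≠ 0 := fun h => by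
      have := ht.eq_zero_iff.2 h
      omega
    obtain ⟨u, _, hu⟩ := ht.prev v hv
    exact ih (v := u) (by omega) (by omega)

theorem le (v : Fin (n + 1)) : t v ≤ n := by
  have h : Finset.range (t v + 1) ⊆ Finset.univ.image t := by
    intro k hk
    obtain ⟨u, hu⟩ := ht.exists_eq (Nat.lt_succ_iff.1 (Finset.mem_range.1 hk))
    exact Finset.mem_image.2 ⟨u, Finset.mem_univ _, hu⟩
  have := (Finset.card_le_card h).trans Finset.card_image_le
  simp only [Finset.card_range, Finset.card_univ, Fintype.card_fin] at this
  omega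

/-- A neighbour cannot be on the same level, so the neighbours counted by `lowHeight` and `slack`
are those not on a level two or more below. -/
theorem lowHeight_add_slack (i : Fin n) :
    lowHeight R t i + slack R t i.succ = nb R i.succ fun u => t i.succ ≤ t u + 1 := by
  rw [add_comm]
  refine (nb_add (fun u hu => ?_) fun u _ h1 h2 => by omega).symm
  have := ht.even_of_adj hu
  grind

theorem lowHeight_add (i : Fin n) :
    lowHeight R t i + nb R i.succ (fun u => t u < t i.succ) = nb R i.succ fun _ => True := by
  refine (nb_add (fun u hu => ?_) fun u _ h1 h2 => by omega).symm
  have := ht.even_of_adj hu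
  grind

end IsLevel

theorem Fits.lt_deg {R : Finset (Fin (n + 1))} {t : Fin (n + 1) → ℕ} (ht : IsLevel R t)
    {x : Config n} (hx : Fits R t x) (i : Fin n) : x i < nb R i.succ fun _ => True := by
  refine (hx i).2.trans_le ?_
  rw [ht.lowHeight_add_slack]
  exact nb_mono fun _ _ _ => trivial

/-! ### Toppling -/

section Sandpile

variable {G : SimpleGraph (Fin (n + 1))}

/-- An independent set of unstable vertices can be toppled one vertex at a time. -/
theorem reflTransGen_toppleSet {S : Finset (Fin (n + 1))} {c : Config n} (hS : S ⊆ unstable G c)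
    (hind : ∀ u ∈ S, ∀ v ∈ S, ¬ G.Adj u v) :
    Relation.ReflTransGen (TopplesTo G) c (toppleSet G S c) := by
  induction S using Finset.induction_on with
  | empty =>
    have : toppleSet G ∅ c = c := by
      funext i
      simp [toppleSet]
    rw [this]
  | insert v S hv ih =>
    have ih := ih (fun u hu => hS (Finset.mem_insert_of_mem hu)) fun u hu w hw =>
      hind u (Finset.mem_insert_of_mem hu) w (Finset.mem_insert_of_mem hw)
    refine ih.tail ⟨v, ?_, ?_⟩
    · have := hS (Finset.mem_insert_self v S)
      simp only [unstable, Finset.mem_filter, Finset.mem_univ, true_and] at this ⊢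
      obtain ⟨i, rfl, hi⟩ := this
      refine ⟨i, rfl, ?_⟩
      simp only [toppleSet, if_neg hv]
      omega
    · funext i
      have hcard : ((insert v S).filter fun u => G.Adj u i.succ).card =
          (S.filter fun u => G.Adj u i.succ).card +
            (({v} : Finset (Fin (n + 1))).filter fun u => G.Adj u i.succ).card := by
        rw [Finset.insert_eq, Finset.filter_union, Finset.card_union_of_disjoint, add_comm]
        exact Finset.disjoint_filter_filter (Finset.disjoint_singleton_left.2 hv)
      have hz : i.succ ∈ insert v S →
          ((insert v S).filter fun u => G.Adj u i.succ).card = 0 := by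
        intro hi
        rw [Finset.card_eq_zero, Finset.filter_eq_empty_iff]
        exact fun u hu => hind u hu _ hi
      simp only [toppleSet, Finset.mem_insert, Finset.mem_singleton] at hz ⊢
      by_cases h1 : i.succ = v
      · have h2 : i.succ ∉ S := h1 ▸ hv
        have := hz (Or.inl h1)
        simp only [h1, true_or, if_true, if_neg hv] at this hcard ⊢
        omega
      · by_cases h2 : i.succ ∈ S
        · have := hz (Or.inr h2)
          simp only [h1, h2, or_true, if_true, if_false]
          omega
        · simp only [h1, h2, or_false, if_false]
          omega

theorem TopplesTo.add {c c' : Config n} (h : TopplesTo G c c') (b : Config n) :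
    TopplesTo G (c + b) (c' + b) := by
  obtain ⟨v, hv, rfl⟩ := h
  simp only [unstable, Finset.mem_filter, Finset.mem_univ, true_and] at hv
  obtain ⟨i, rfl, hi⟩ := hv
  refine ⟨i.succ, ?_, ?_⟩
  · simp only [unstable, Finset.mem_filter, Finset.mem_univ, true_and]
    exact ⟨i, rfl, hi.trans (Nat.le_add_right _ _)⟩
  · funext j
    simp only [toppleSet, Pi.add_apply, Finset.mem_singleton]
    by_cases h : j.succ = i.succ
    · obtain rfl := Fin.succ_injective _ h
      simp only [if_true]
      omega
    · simp only [if_neg h]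
      omega

theorem reflTransGen_add {c c' : Config n} (h : Relation.ReflTransGen (TopplesTo G) c c')
    (b : Config n) : Relation.ReflTransGen (TopplesTo G) (c + b) (c' + b) :=
  h.lift (· + b) fun _ _ h => h.add b

/-- No set of vertices avoiding the sink is a forbidden subconfiguration: some vertex of the set is
at least as high as its number of neighbours in the set. -/
def NoForbidden (G : SimpleGraph (Fin (n + 1))) (c : Config n) : Prop :=
  ∀ S : Finset (Fin (n + 1)), S.Nonempty → 0 ∉ S →
    ∃ i : Fin n, i.succ ∈ S ∧ (S.filter fun u => G.Adj u i.succ).card ≤ c i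

theorem NoForbidden.mono {c c' : Config n} (h : NoForbidden G c) (hc : ∀ i, c i ≤ c' i) :
    NoForbidden G c' := by
  intro S hS h0
  obtain ⟨i, hi, h⟩ := h S hS h0
  exact ⟨i, hi, h.trans (hc i)⟩

/-- If `S` is forbidden after toppling `v`, then `S` without `v` was forbidden before. -/
theorem NoForbidden.topplesTo {c c' : Config n} (h : NoForbidden G c) (hc : TopplesTo G c c') :
    NoForbidden G c' := by
  obtain ⟨v, -, rfl⟩ := hc
  intro S hS h0
  by_cases hE : (S.erase v).Nonempty
  · obtain ⟨i, hi, hle⟩ := h (S.erase v) hE fun h => h0 (Finset.mem_of_mem_erase h)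
    have hiv := Finset.ne_of_mem_erase hi
    refine ⟨i, Finset.mem_of_mem_erase hi, ?_⟩
    have hsub : (S.filter fun u => G.Adj u i.succ) ⊆
        ((S.erase v).filter fun u => G.Adj u i.succ) ∪
          (({v} : Finset (Fin (n + 1))).filter fun u => G.Adj u i.succ) := by
      intro u hu
      simp only [Finset.mem_filter, Finset.mem_union, Finset.mem_erase, Finset.mem_singleton] at hu ⊢
      tauto
    have := (Finset.card_le_card hsub).trans (Finset.card_union_le _ _)
    simp only [toppleSet, Finset.mem_singleton, if_neg hiv]
    omega
  · obtain ⟨w, hw⟩ := hS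
    have hwv : ∀ u ∈ S, u = v := by
      intro u hu
      by_contra huv
      exact hE ⟨u, Finset.mem_erase.2 ⟨huv, hu⟩⟩
    obtain ⟨i, rfl⟩ := Fin.exists_succ_eq.2 (fun h : w = 0 => h0 (h ▸ hw))
    refine ⟨i, hw, ?_⟩
    rw [Finset.card_eq_zero.2]
    · exact Nat.zero_le _
    · rw [Finset.filter_eq_empty_iff]
      intro u hu
      rw [hwv u hu, hwv _ hw]
      exact G.loopless.irrefl v

end Sandpile

section Recurrent

variable {F : YoungDiagram} (hF : semiperimeter F = n + 1)
include hF

theorem deg_eq (v : Fin (n + 1)) : deg (ferrersGraph n F) v = nb (rows n F) v fun _ => True := by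
  unfold deg nb
  congr 1
  ext u
  simp only [Finset.mem_filter, Finset.mem_univ, true_and, and_true]
  rw [adj_iff hF, fAdj_comm]

theorem card_filter_adj (S : Finset (Fin (n + 1))) (v : Fin (n + 1)) :
    (S.filter fun u => (ferrersGraph n F).Adj u v).card = nb (rows n F) v (· ∈ S) := by
  unfold nb
  congr 1
  ext u
  simp only [Finset.mem_filter, Finset.mem_univ, true_and]
  rw [adj_iff hF, and_comm]

theorem toppleSet_apply (S : Finset (Fin (n + 1))) (c : Config n) (i : Fin n) :
    toppleSet (ferrersGraph n F) S c i = c i + nb (rows n F) i.succ (· ∈ S) -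
      if i.succ ∈ S then nb (rows n F) i.succ fun _ => True else 0 := by
  rw [toppleSet, card_filter_adj hF, deg_eq hF]

theorem mem_unstable {c : Config n} {i : Fin n} :
    i.succ ∈ unstable (ferrersGraph n F) c ↔ nb (rows n F) i.succ (fun _ => True) ≤ c i := by
  simp only [unstable, Finset.mem_filter, Finset.mem_univ, true_and, deg_eq hF]
  constructor
  · rintro ⟨j, hj, h⟩
    obtain rfl := Fin.succ_injective _ hj
    exact h
  · exact fun h => ⟨i, rfl, h⟩

omit hF in
theorem zero_notMem_unstable {G : SimpleGraph (Fin (n + 1))} {c : Config n} :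
    0 ∉ unstable G c := by
  simp only [unstable, Finset.mem_filter, Finset.mem_univ, true_and, not_exists, not_and]
  exact fun i h => absurd h (Fin.succ_ne_zero i).symm

theorem not_adj_of_subset {S : Finset (Fin (n + 1))}
    (hS : S ⊆ rows n F ∨ S ⊆ cols n F) : ∀ u ∈ S, ∀ v ∈ S, ¬ (ferrersGraph n F).Adj u v := by
  intro u hu v hv h
  rw [adj_iff hF] at h
  rcases hS with hS | hS
  · exact h.mem_iff.1 (hS hu) (hS hv)
  · exact (mem_cols hF).1 (hS hu) (h.mem_iff.2 ((mem_cols hF).1 (hS hv)))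

variable {t : Fin (n + 1) → ℕ} {x : Config n} (ht : IsLevel (rows n F) t)
  (hx : Fits (rows n F) t x)
include ht hx

/-- Stage `k` topples the vertices of level `k`. Two neighbouring levels differ in parity, so a
vertex of level `k + 1` has received grains from all neighbours but those of later levels, while a
vertex of level at least `k + 3` has not yet received any from the level just before its own. -/
theorem nextBlock_eq {k : ℕ} {s : Config n}
    (hs : ∀ i, s i = x i + nb (rows n F) i.succ (fun u => t u ≤ k) -
      if t i.succ ≤ k then nb (rows n F) i.succ fun _ => True else 0) (v : Fin (n + 1)) :
    v ∈ nextBlock F k s ↔ t v = k + 1 := by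
  unfold nextBlock
  rw [Finset.mem_inter]
  induction v using Fin.cases with
  | zero =>
    simp only [zero_notMem_unstable, false_and, ht.zero, false_iff]
    omega
  | succ i =>
    rw [mem_unstable hF, hs i]
    have hpar : (i.succ ∈ if Even k then cols n F else rows n F) ↔
        (Even k ↔ ¬ Even (t i.succ)) := by
      rw [ht.even_iff]
      split_ifs with h <;> simp [h, mem_cols hF]
    rw [hpar]
    have hlow := hx i
    have hle : nb (rows n F) i.succ (fun u => t u ≤ k) ≤ nb (rows n F) i.succ fun _ => True :=
      nb_mono fun _ _ _ => trivial
    have hdeg := Fits.lt_deg ht hx i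
    rcases lt_trichotomy (t i.succ) (k + 1) with h | h | h
    · rw [if_pos (Nat.lt_succ_iff.1 h)]
      refine ⟨fun h' => ?_, fun h' => by omega⟩
      omega
    · rw [if_neg (by omega)]
      refine ⟨fun _ => h, fun _ => ⟨?_, ?_⟩⟩
      · have h1 := ht.lowHeight_add i
        simp only [h, Nat.lt_succ_iff] at h1
        omega
      · rw [h]
        grind
    · rw [if_neg (by omega)]
      refine ⟨fun ⟨h1, h2⟩ => ?_, fun h' => by omega⟩
      have h3 : t i.succ ≠ k + 2 := by
        intro h3
        rw [h3] at h2
        grind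
      have h4 : nb (rows n F) i.succ (fun u => t u ≤ k) +
          nb (rows n F) i.succ (fun u => t i.succ ≤ t u + 1) ≤
            nb (rows n F) i.succ fun _ => True := by
        rw [← nb_add (r := fun u => t u ≤ k ∨ t i.succ ≤ t u + 1) (fun _ _ => Iff.rfl)]
        · exact nb_mono fun _ _ _ => trivial
        · intro u _ h5 h6
          omega
      rw [← ht.lowHeight_add_slack] at h4
      omega

theorem canonState_apply (k : ℕ) (i : Fin n) :
    canonState F x k i = x i + nb (rows n F) i.succ (fun u => t u ≤ k) -
      if t i.succ ≤ k then nb (rows n F) i.succ fun _ => True else 0 := by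
  induction k generalizing i with
  | zero =>
    rw [canonState, toppleSet_apply hF]
    simp only [Finset.mem_singleton, Nat.le_zero, ht.eq_zero_iff]
  | succ k ih =>
    rw [canonState, toppleSet_apply hF]
    have h1 := nextBlock_eq hF ht hx (k := k) ih
    simp only [h1]
    rw [ih, nb_add (r := fun u => t u ≤ k + 1) (p := fun u => t u ≤ k) (q := fun u => t u = k + 1)
      (fun u _ => by omega) (fun u _ h1 h2 => by omega)]
    have hlow := hx i
    by_cases h : t i.succ ≤ k
    · rw [if_pos h, if_neg (by omega), if_pos (by omega)]
      have : nb (rows n F) i.succ (fun _ => True) ≤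
          x i + nb (rows n F) i.succ (fun u => t u ≤ k) := by
        have h1 := ht.lowHeight_add i
        have h2 : nb (rows n F) i.succ (fun u => t u < t i.succ) ≤
          nb (rows n F) i.succ (fun u => t u ≤ k) := nb_mono fun u _ h' => by omega
        omega
      omega
    · rw [if_neg h]
      by_cases h' : t i.succ = k + 1
      · rw [if_pos h', if_pos (by omega)]
        omega
      · rw [if_neg h', if_neg (by omega)]
        omega

theorem mem_canonTop {k : ℕ} {v : Fin (n + 1)} : v ∈ canonTop F x k ↔ t v = k := by
  cases k with
  | zero => rw [canonTop, Finset.mem_singleton, ht.eq_zero_iff]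
  | succ k => exact nextBlock_eq hF ht hx (canonState_apply hF ht hx k) v

/-- Toppling the sink can be followed by legal topplings that lead back to `x`. -/
theorem reflTransGen_toppleSet_zero :
    Relation.ReflTransGen (TopplesTo (ferrersGraph n F))
      (toppleSet (ferrersGraph n F) {0} x) x := by
  have key : ∀ k, Relation.ReflTransGen (TopplesTo (ferrersGraph n F))
      (toppleSet (ferrersGraph n F) {0} x) (canonState F x k) := by
    intro k
    induction k with
    | zero => exact .refl
    | succ k ih =>
      refine ih.trans (reflTransGen_toppleSet Finset.inter_subset_left (not_adj_of_subset hF ?_))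
      unfold nextBlock
      split_ifs
      · exact Or.inr Finset.inter_subset_right
      · exact Or.inl Finset.inter_subset_right
  have : canonState F x n = x := by
    funext i
    rw [canonState_apply hF ht hx, if_pos (ht.le _),
      nb_congr (q := fun _ => True) fun u _ => iff_true_intro (ht.le u)]
    omega
  exact (congrArg _ this).mp (key n)

/-- Firing the sink `2 * n + 2` times and then reversing one toppling of every row other than the
sink leads from `x` to a configuration `e` above the maximally stable one: the reversals give each
row as many grains as its degree, at a cost of at most `n + 1` to each column. The configuration `e`
topples back to `x`, since the rows can be toppled, after which the firings of the sink are undone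
one by one (`reflTransGen_toppleSet_zero`). -/
theorem mem_recurrent_of_fits (hn : 1 ≤ n) : x ∈ recurrent (ferrersGraph n F) := by
  set G := ferrersGraph n F
  have hstab : IsStable G x := fun i => by
    rw [deg_eq hF]
    exact Fits.lt_deg ht hx i
  have hsink : ∀ c : Config n, ∀ i, toppleSet G {0} c i =
      c i + nb (rows n F) i.succ (· = 0) := by
    intro c i
    rw [toppleSet_apply hF]
    simp [Fin.succ_ne_zero]
  have hburn : ∀ N : ℕ, Relation.ReflTransGen (TopplesTo G)
      (fun i => x i + N * nb (rows n F) i.succ (· = 0)) x := by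
    intro N
    induction N with
    | zero => simpa using Relation.ReflTransGen.refl
    | succ N ih =>
      refine Relation.ReflTransGen.trans ?_ ih
      have h := reflTransGen_add (reflTransGen_toppleSet_zero hF ht hx)
        (fun i => N * nb (rows n F) i.succ (· = 0))
      have e : (fun i => x i + (N + 1) * nb (rows n F) i.succ (· = 0)) =
          toppleSet G {0} x + fun i => N * nb (rows n F) i.succ (· = 0) := by
        funext i
        rw [Pi.add_apply, hsink]
        ring
      rw [e]
      exact h
  let S : Finset (Fin (n + 1)) := rows n F \ {0}
  let e : Config n := fun i =>
    if i.succ ∈ rows n F then x i + nb (rows n F) i.succ fun _ => True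
    else x i + (2 * n + 2) - nb (rows n F) i.succ (· ∈ S)
  have hS : ∀ i : Fin n, i.succ ∈ S ↔ i.succ ∈ rows n F := by
    intro i
    simp [S, Fin.succ_ne_zero]
  have he : Relation.ReflTransGen (TopplesTo G) e x := by
    refine (reflTransGen_toppleSet (S := S) ?_ ?_).trans ?_
    · intro v hv
      induction v using Fin.cases with
      | zero => simp [S] at hv
      | succ i =>
        rw [mem_unstable hF]
        simp only [e, if_pos ((hS i).1 hv)]
        omega
    · exact not_adj_of_subset hF (Or.inl Finset.sdiff_subset)
    · convert hburn (2 * n + 2) using 1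
      funext i
      rw [toppleSet_apply hF]
      by_cases hi : i.succ ∈ rows n F
      · simp only [e, hS, if_pos hi]
        rw [nb_eq_zero (p := (· = 0)), nb_eq_zero (p := (· ∈ S))]
        · omega
        · intro u hu hu'
          exact hu.mem_iff.1 (Finset.mem_sdiff.1 hu').1 hi
        · rintro u hu rfl
          exact hu.mem_iff.1 (zero_mem_rows hF hn) hi
      · simp only [e, hS, if_neg hi]
        have h1 : nb (rows n F) i.succ (· = 0) = 1 := by
          unfold nb
          rw [Finset.card_eq_one]
          refine ⟨0, ?_⟩
          ext u
          simp only [Finset.mem_filter, Finset.mem_univ, true_and, Finset.mem_singleton,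
            and_iff_right_iff_imp]
          rintro rfl
          exact Or.inl ⟨zero_mem_rows hF hn, hi, Fin.succ_pos i⟩
        have h2 := nb_le (R := rows n F) (v := i.succ) (p := (· ∈ S))
        rw [h1]
        omega
  refine ⟨fun i => e i - maxStable G i, ?_, hstab⟩
  convert he using 1
  funext i
  have : maxStable G i ≤ e i := by
    rw [maxStable, deg_eq hF]
    simp only [e]
    have h1 := nb_le (R := rows n F) (v := i.succ) (p := (· ∈ S))
    have h2 := nb_le (R := rows n F) (v := i.succ) (p := fun _ => True)
    split_ifs <;> omega
  rw [Pi.add_apply]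
  omega

end Recurrent

/-! ### Recurrent configurations -/

/-- The vertices toppled up to stage `k` of the canonical toppling of `x`. A stage adds the vertices
of the right parity that are unstable once their already toppled neighbours have sent them a grain
each; no vertex is ever removed. -/
def burn (R : Finset (Fin (n + 1))) (x : Config n) : ℕ → Finset (Fin (n + 1))
  | 0 => {0}
  | k + 1 => burn R x k ∪ Finset.univ.filter fun v => (Even (k + 1) ↔ v ∈ R) ∧
      ∃ i : Fin n, v = i.succ ∧ nb R v (fun _ => True) ≤ x i + nb R v (· ∈ burn R x k)

theorem burn_mono {R : Finset (Fin (n + 1))} {x : Config n} : Monotone (burn R x) :=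
  monotone_nat_of_le_succ fun _ => Finset.subset_union_left

theorem succ_mem_burn {R : Finset (Fin (n + 1))} {x : Config n} {k : ℕ} {i : Fin n} :
    i.succ ∈ burn R x (k + 1) ↔ i.succ ∈ burn R x k ∨ ((Even (k + 1) ↔ i.succ ∈ R) ∧
      nb R i.succ (fun _ => True) ≤ x i + nb R i.succ (· ∈ burn R x k)) := by
  rw [burn, Finset.mem_union, Finset.mem_filter]
  refine or_congr_right ?_
  simp only [Finset.mem_univ, true_and]
  refine and_congr_right fun _ => ⟨?_, fun h => ⟨i, rfl, h⟩⟩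
  rintro ⟨j, hj, h⟩
  obtain rfl := Fin.succ_injective _ hj
  exact h

section

variable {F : YoungDiagram} (hF : semiperimeter F = n + 1)
include hF

/-- A set of vertices avoiding the sink either contains a column, which has the sink as a neighbour
outside the set, or is an independent set of rows. -/
theorem noForbidden_maxStable (hn : 1 ≤ n) :
    NoForbidden (ferrersGraph n F) (maxStable (ferrersGraph n F)) := by
  intro S hS h0
  by_cases h : S ⊆ rows n F
  · obtain ⟨v, hv⟩ := hS
    obtain ⟨i, rfl⟩ := Fin.exists_succ_eq.2 (fun h : v = 0 => h0 (h ▸ hv))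
    refine ⟨i, hv, ?_⟩
    rw [card_filter_adj hF, nb_eq_zero]
    · exact Nat.zero_le _
    · exact fun u hu huS => hu.mem_iff.1 (h huS) (h hv)
  · obtain ⟨v, hv, hvR⟩ := Finset.not_subset.1 h
    obtain ⟨i, rfl⟩ := Fin.exists_succ_eq.2 (fun h : v = 0 => h0 (h ▸ hv))
    refine ⟨i, hv, ?_⟩
    rw [card_filter_adj hF, maxStable, deg_eq hF]
    have h1 := nb_add (R := rows n F) (v := i.succ) (r := fun u => u ∈ S ∨ u = 0) (p := (· ∈ S))
      (q := (· = 0)) (fun _ _ => Iff.rfl) (fun u _ hu hu' => h0 (hu' ▸ hu))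
    have h2 : 0 < nb (rows n F) i.succ (· = 0) :=
      nb_pos.2 ⟨0, Or.inl ⟨zero_mem_rows hF hn, hvR, Fin.succ_pos i⟩, rfl⟩
    have h3 : nb (rows n F) i.succ (fun u => u ∈ S ∨ u = 0) ≤ nb (rows n F) i.succ fun _ => True :=
      nb_mono fun _ _ _ => trivial
    omega

theorem noForbidden_of_mem_recurrent (hn : 1 ≤ n) {x : Config n}
    (hx : x ∈ recurrent (ferrersGraph n F)) : NoForbidden (ferrersGraph n F) x := by
  obtain ⟨a, hx, -⟩ := hx
  induction hx with
  | refl => exact (noForbidden_maxStable hF hn).mono fun i => Nat.le_add_right _ _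
  | tail _ h ih => exact ih.topplesTo h

theorem exists_mem_burn {x : Config n} (hx : NoForbidden (ferrersGraph n F) x)
    (v : Fin (n + 1)) : ∃ k, v ∈ burn (rows n F) x k := by
  by_contra! hv
  let S : Finset (Fin (n + 1)) := Finset.univ.filter fun u => ∀ k, u ∉ burn (rows n F) x k
  obtain ⟨i, hi, hle⟩ := hx S ⟨v, by simpa [S] using hv⟩ (by
    simp only [S, Finset.mem_filter, Finset.mem_univ, true_and, not_forall, not_not]
    exact ⟨0, Finset.mem_singleton_self 0⟩)
  rw [card_filter_adj hF] at hle
  have hi : ∀ k, i.succ ∉ burn (rows n F) x k := by simpa [S] using hi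
  have hK : ∃ K, ∀ u, u ∉ S → u ∈ burn (rows n F) x K := by
    have : ∀ u, ∃ k, u ∉ S → u ∈ burn (rows n F) x k := by
      intro u
      by_cases hu : u ∈ S
      · exact ⟨0, fun h => absurd hu h⟩
      · simp only [S, Finset.mem_filter, Finset.mem_univ, true_and, not_forall, not_not] at hu
        obtain ⟨k, hk⟩ := hu
        exact ⟨k, fun _ => hk⟩
    choose f hf using this
    exact ⟨Finset.univ.sup f, fun u hu =>
      burn_mono (Finset.le_sup (f := f) (Finset.mem_univ u)) (hf u hu)⟩
  obtain ⟨K, hK⟩ := hK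
  -- One of the next two stages is the turn of `i`.
  obtain ⟨k, hKk, hk⟩ : ∃ k, K ≤ k ∧ (Even (k + 1) ↔ i.succ ∈ rows n F) := by
    by_cases h : Even (K + 1) ↔ i.succ ∈ rows n F
    · exact ⟨K, le_rfl, h⟩
    · exact ⟨K + 1, Nat.le_succ K, by grind⟩
  refine hi (k + 1) (succ_mem_burn.2 (Or.inr ⟨hk, ?_⟩))
  have h1 := nb_add (R := rows n F) (v := i.succ) (r := fun _ => True) (p := (· ∈ S))
    (q := (· ∉ S)) (fun u _ => by simp [em]) (fun u _ hu hu' => hu' hu)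
  have h2 : nb (rows n F) i.succ (· ∉ S) ≤ nb (rows n F) i.succ (· ∈ burn (rows n F) x k) :=
    nb_mono fun u _ hu => burn_mono hKk (hK u hu)
  omega

/-- The level of a vertex is the stage at which it topples. -/
theorem exists_isLevel_of_mem_recurrent (hn : 1 ≤ n) {x : Config n}
    (hx : x ∈ recurrent (ferrersGraph n F)) :
    ∃ t, IsLevel (rows n F) t ∧ Fits (rows n F) t x := by
  have hstab : ∀ i, x i < nb (rows n F) i.succ fun _ => True := by
    obtain ⟨a, -, h⟩ := hx
    intro i
    rw [← deg_eq hF]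
    exact h i
  have hex := exists_mem_burn hF (noForbidden_of_mem_recurrent hF hn hx)
  set R := rows n F with hR
  have h0 : 0 ∈ R := zero_mem_rows hF hn
  obtain ⟨t, ht⟩ : ∃ t : Fin (n + 1) → ℕ, ∀ v k, v ∈ burn R x k ↔ t v ≤ k :=
    ⟨fun v => Nat.find (hex v), fun v k => ⟨fun h => Nat.find_min' _ h,
      fun h => burn_mono h (Nat.find_spec (hex v))⟩⟩
  have tz : t 0 = 0 := Nat.le_zero.1 ((ht 0 0).1 (Finset.mem_singleton_self 0))
  have tpos : ∀ i : Fin n, 0 < t i.succ := by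
    intro i
    by_contra h
    have := (ht i.succ 0).2 (by omega)
    exact Fin.succ_ne_zero i (Finset.mem_singleton.1 this)
  have tsucc : ∀ (i : Fin n) k, t i.succ = k + 1 → ((Even (k + 1) ↔ i.succ ∈ R) ∧
      nb R i.succ (fun _ => True) ≤ x i + nb R i.succ (t · ≤ k)) := by
    intro i k h
    have h1 := succ_mem_burn.1 ((ht i.succ (k + 1)).2 h.le)
    simp only [ht] at h1
    exact h1.resolve_left (by omega)
  have tnot : ∀ (i : Fin n) k, k + 1 < t i.succ → (Even (k + 1) ↔ i.succ ∈ R) →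
      x i + nb R i.succ (t · ≤ k) < nb R i.succ (fun _ => True) := by
    intro i k h hk
    by_contra h'
    have h1 := (ht i.succ (k + 1)).1
      (succ_mem_burn.2 (Or.inr ⟨hk, by simpa only [ht] using not_lt.1 h'⟩))
    omega
  have teven : ∀ v, Even (t v) ↔ v ∈ R := by
    intro v
    induction v using Fin.cases with
    | zero => simp [tz, h0]
    | succ i =>
      obtain ⟨k, hk⟩ := Nat.exists_eq_add_of_lt (tpos i)
      rw [zero_add] at hk
      rw [hk]
      exact (tsucc i k hk).1
  have tadj : ∀ u v, FAdj R u v → (Even (t u) ↔ ¬ Even (t v)) := by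
    intro u v h
    rw [teven, teven]
    exact h.mem_iff
  have hfits : Fits R t x := by
    intro i
    obtain ⟨k, hk⟩ := Nat.exists_eq_add_of_lt (tpos i)
    rw [zero_add] at hk
    constructor
    · have h1 := (tsucc i k hk).2
      have h2 : nb R i.succ (fun _ => True) = nb R i.succ (t · ≤ k) + lowHeight R t i := by
        refine nb_add (fun u hu => ?_) fun u _ h1 h2 => by omega
        have := tadj u _ hu
        grind
      omega
    · have h1 : lowHeight R t i + slack R t i.succ = nb R i.succ fun u => t i.succ ≤ t u + 1 := by
        rw [add_comm]
        refine (nb_add (fun u hu => ?_) fun u _ h1 h2 => by omega).symm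
        have := tadj u _ hu
        grind
      rw [h1]
      rcases Nat.lt_or_ge k 2 with h2 | h2
      · refine (hstab i).trans_le (nb_mono fun u hu _ => ?_)
        have := tadj u _ hu
        grind
      · obtain ⟨l, rfl⟩ := Nat.exists_eq_add_of_le' h2
        have h3 := tnot i l (by omega) (by
          rw [← teven, hk]
          grind)
        have h4 : nb R i.succ (fun _ => True) =
            nb R i.succ (t · ≤ l) + nb R i.succ fun u => t i.succ ≤ t u + 1 := by
          refine nb_add (fun u hu => ?_) fun u _ h1 h2 => by omega
          have := tadj u _ hu
          grind
        omega
  refine ⟨t, ⟨tz, teven, fun v hv => ?_⟩, hfits⟩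
  obtain ⟨i, rfl⟩ := Fin.exists_succ_eq.2 hv
  have := hfits i
  exact nb_pos.1 (show 0 < slack R t i.succ by omega)

end

/-- Every edge not incident with the sink is counted once, at its end of smaller level. -/
theorem IsLevel.sum_lowHeight {R : Finset (Fin (n + 1))} {t : Fin (n + 1) → ℕ}
    (ht : IsLevel R t) (h0 : 0 ∈ R) :
    2 * (∑ i, lowHeight R t i + nb R 0 fun _ => True) = ∑ v, nb R v fun _ => True := by
  have h1 : ∑ i, lowHeight R t i + nb R 0 (fun _ => True) = ∑ v, nb R v fun u => t v < t u := by
    rw [Fin.sum_univ_succ, add_comm]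
    congr 1
    refine nb_congr fun u hu => ?_
    simp only [true_iff, ht.zero]
    exact Nat.pos_of_ne_zero fun h => hu.mem_iff.1 ((ht.even_iff u).1 (by simp [h])) h0
  have h2 : ∑ v, nb R v (fun u => t v < t u) = ∑ v, nb R v fun u => t u < t v := by
    unfold nb
    simp only [Finset.card_filter]
    rw [Finset.sum_comm]
    simp only [fAdj_comm]
  have h3 : ∑ v, nb R v (fun _ => True) =
      ∑ v, nb R v (fun u => t v < t u) + ∑ v, nb R v fun u => t u < t v := by
    rw [← Finset.sum_add_distrib]
    refine Finset.sum_congr rfl fun v _ => nb_add (fun u hu => ?_) fun u _ h1 h2 => by omega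
    have := ht.even_of_adj hu
    grind
  omega

section

variable {F : YoungDiagram} (hF : semiperimeter F = n + 1) (hn : 1 ≤ n)
  {t : Fin (n + 1) → ℕ} (ht : IsLevel (rows n F) t)
include hF hn ht

theorem lowHeight_mem_minRecurrent :
    lowHeight (rows n F) t ∈ minRecurrent (ferrersGraph n F) := by
  refine ⟨mem_recurrent_of_fits hF ht ht.fits_lowHeight hn, fun c hc => ?_⟩
  obtain ⟨s, hs, hcs⟩ := exists_isLevel_of_mem_recurrent hF hn hc
  have h1 := ht.sum_lowHeight (zero_mem_rows hF hn)
  have h2 := hs.sum_lowHeight (zero_mem_rows hF hn)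
  have h3 : ∑ i, lowHeight (rows n F) s i ≤ ∑ i, c i :=
    Finset.sum_le_sum fun i _ => (hcs i).1
  omega

theorem minrec_eq {x : Config n} (hx : Fits (rows n F) t x) :
    minrec F x = lowHeight (rows n F) t := by
  have hlow := lowHeight_mem_minRecurrent hF hn ht
  have hspec : minrec F x ∈ minRecurrent (ferrersGraph n F) ∧
      canonTop F (minrec F x) = canonTop F x := by
    refine Classical.epsilon_spec (p := fun c => c ∈ minRecurrent (ferrersGraph n F) ∧
      canonTop F c = canonTop F x) ⟨_, hlow, ?_⟩
    funext k
    ext v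
    rw [mem_canonTop hF ht hx, mem_canonTop hF ht ht.fits_lowHeight]
  generalize minrec F x = c at hspec
  obtain ⟨⟨hc, hmin⟩, htop⟩ := hspec
  obtain ⟨s, hs, hcs⟩ := exists_isLevel_of_mem_recurrent hF hn hc
  obtain rfl : s = t := by
    funext v
    have h1 : v ∈ canonTop F c (s v) := (mem_canonTop hF hs hcs).2 rfl
    rw [htop, mem_canonTop hF ht hx] at h1
    exact h1.symm
  have hle := hmin _ hlow.1
  have := (Finset.sum_eq_sum_iff_of_le fun i _ => (hcs i).1).1
    (le_antisymm (Finset.sum_le_sum fun i _ => (hcs i).1) hle)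
  exact funext fun i => (this i (Finset.mem_univ i)).symm

end

/-! ### Fillings and level functions -/

theorem fin_two_eq (a : Fin 2) : a = 0 ∨ a = 1 := by
  revert a
  decide

/-- The filling with a 1 in the cells whose row has a smaller level than their column. -/
def levelFilling (F : YoungDiagram) (t : Fin (n + 1) → ℕ) : Filling F := fun p =>
  if t (Fin.ofNat (n + 1) (rowLabel F p.1.1)) < t (Fin.ofNat (n + 1) (colLabel F p.1.2))
    then 1 else 0

theorem levelFilling_apply {F : YoungDiagram} {t : Fin (n + 1) → ℕ} {p : {p : ℕ × ℕ // p ∈ F}}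
    {u v : Fin (n + 1)} (hu : (u : ℕ) = rowLabel F p.1.1) (hv : (v : ℕ) = colLabel F p.1.2) :
    levelFilling F t p = if t u < t v then 1 else 0 := by
  rw [levelFilling, ← hu, ← hv, Fin.ofNat_val_eq_self, Fin.ofNat_val_eq_self]

section

variable {F : YoungDiagram} (hF : semiperimeter F = n + 1)
include hF

theorem exists_labels (p : {p : ℕ × ℕ // p ∈ F}) : ∃ u v : Fin (n + 1),
    (u : ℕ) = rowLabel F p.1.1 ∧ (v : ℕ) = colLabel F p.1.2 :=
  ⟨⟨_, rowLabel_le hF (row_lt_of_mem p.2)⟩, ⟨_, colLabel_le hF (col_lt_of_mem p.2)⟩, rfl, rfl⟩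

theorem labels_mem {p : {p : ℕ × ℕ // p ∈ F}} {u v : Fin (n + 1)}
    (hu : (u : ℕ) = rowLabel F p.1.1) (hv : (v : ℕ) = colLabel F p.1.2) :
    u ∈ rows n F ∧ v ∉ rows n F ∧ u < v := by
  refine ⟨rowLabel_mem (row_lt_of_mem p.2) hu, colLabel_not_mem hF (col_lt_of_mem p.2) hv, ?_⟩
  rw [Fin.lt_def, hu, hv]
  exact rowLabel_lt_colLabel p.2

theorem exists_cell {u v : Fin (n + 1)} (hu : u ∈ rows n F) (hv : v ∉ rows n F) (h : u < v) :
    ∃ p : {p : ℕ × ℕ // p ∈ F}, (u : ℕ) = rowLabel F p.1.1 ∧ (v : ℕ) = colLabel F p.1.2 := by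
  obtain ⟨i, _, hu⟩ := exists_row hu
  obtain ⟨j, hj, hv⟩ := exists_col hF hv
  exact ⟨⟨(i, j), (mem_iff_lt hj).2 (by rwa [← hu, ← hv])⟩, hu, hv⟩

section Level

variable {t : Fin (n + 1) → ℕ} (ht : IsLevel (rows n F) t)
include ht

theorem phiCT_eq {x : Config n} (hx : Fits (rows n F) t x) : phiCT F x = levelFilling F t := by
  funext p
  obtain ⟨u, v, hu, hv⟩ := exists_labels hF p
  rw [levelFilling_apply hu hv, phiCT]
  congr 1
  refine propext ⟨?_, fun h => ?_⟩
  · rintro ⟨k, l, hkl, u', hu', v', hv', h1, h2⟩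
    obtain rfl : u' = u := Fin.ext (h1.trans hu.symm)
    obtain rfl : v' = v := Fin.ext (h2.trans hv.symm)
    rw [mem_canonTop hF ht hx] at hu' hv'
    omega
  · exact ⟨t u, t v, h, u, (mem_canonTop hF ht hx).2 rfl, v, (mem_canonTop hF ht hx).2 rfl, hu, hv⟩

/-- The state of a cell after step `k` of the recording of the filling given by `t`, when `a` and
`b` are the levels of its row and its column: the recording of a row or column flips its entries. -/
def CellOne (k a b : ℕ) : Prop := (a < b ∧ (k < a ∨ b ≤ k)) ∨ (b ≤ k ∧ k < a)

/-- A column of level `k + 1` has only 0s after step `k`, and a row of that level only 1s. For any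
other row or column, the cell that it shares with a neighbour on the level just before its own does
not have the required entry: either neither of the two has been recorded, or both have been. -/
theorem mem_nextRecord {k : ℕ} {S : Filling F}
    (hS : ∀ p, ∀ u v : Fin (n + 1), (u : ℕ) = rowLabel F p.1.1 → (v : ℕ) = colLabel F p.1.2 →
      (S p = 1 ↔ CellOne k (t u) (t v))) (w : Fin (n + 1)) :
    w ∈ nextRecord n F k S ↔ t w = k + 1 := by
  unfold nextRecord
  rw [Finset.mem_filter]
  simp only [Finset.mem_univ, true_and]
  split_ifs with hk
  · constructor
    · rintro ⟨j, hj, hw, hall⟩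
      have hwR := colLabel_not_mem hF hj hw
      have hw0 : w ≠ 0 := fun h => by
        rw [← ht.even_iff, h, ht.zero] at hwR
        exact hwR Even.zero
      obtain ⟨u, hadj, hlev⟩ := ht.prev w hw0
      have huR := hadj.mem_iff.2 hwR
      have hlt : u < w := by
        rcases hadj with h | h
        · exact h.2.2
        · exact absurd h.1 hwR
      obtain ⟨p, hu, hv⟩ := exists_cell hF huR hwR hlt
      have h1 := hall p (colLabel_inj (col_lt_of_mem p.2) hj (hv.symm.trans hw))
      have h2 := (hS p u w hu hv).not.1 (by simp [h1])
      unfold CellOne at h2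
      omega
    · intro hw
      have hwR : w ∉ rows n F := by
        rw [← ht.even_iff, hw]
        grind
      obtain ⟨j, hj, hv⟩ := exists_col hF hwR
      refine ⟨j, hj, hv, ?_⟩
      rintro p rfl
      obtain ⟨u, v, hu, hv'⟩ := exists_labels hF p
      obtain rfl : v = w := Fin.ext (hv'.trans hv.symm)
      refine (fin_two_eq _).resolve_right fun h => ?_
      have := (hS p u v hu hv').1 h
      unfold CellOne at this
      omega
  · constructor
    · rintro ⟨i, hi, hi0, hw, hall⟩
      have hwR := rowLabel_mem hi hw
      have hw0 : w ≠ 0 := by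
        rintro rfl
        have := rowLabel_lt_rowLabel (F := F) hi0
        rw [← hw] at this
        exact absurd this (Nat.not_lt_zero _)
      obtain ⟨u, hadj, hlev⟩ := ht.prev w hw0
      have huR := hadj.symm.mem_iff.1 hwR
      have hlt : w < u := by
        rcases hadj with h | h
        · exact absurd h.1 huR
        · exact h.2.2
      obtain ⟨p, hu, hv⟩ := exists_cell hF hwR huR hlt
      have h1 := hall p (rowLabel_injective (hu.symm.trans hw))
      have h2 := (hS p w u hu hv).1 h1
      unfold CellOne at h2
      omega
    · intro hw
      have hwR : w ∈ rows n F := by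
        rw [← ht.even_iff, hw]
        grind
      obtain ⟨i, hi, hu⟩ := exists_row hwR
      refine ⟨i, hi, Nat.pos_of_ne_zero ?_, hu, ?_⟩
      · rintro rfl
        rw [rowLabel_zero] at hu
        rw [ht.eq_zero_iff.2 (Fin.ext hu)] at hw
        omega
      · rintro p rfl
        obtain ⟨u, v, hu', hv⟩ := exists_labels hF p
        obtain rfl : u = w := Fin.ext (hu'.trans hu.symm)
        rw [hS p u v hu hv]
        have h1 := labels_mem hF hu hv
        have h2 := ht.even_of_adj (Or.inl h1 : FAdj (rows n F) u v)
        unfold CellOne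
        grind

theorem tabState_levelFilling (k : ℕ) (p : {p : ℕ × ℕ // p ∈ F}) (u v : Fin (n + 1))
    (hu : (u : ℕ) = rowLabel F p.1.1) (hv : (v : ℕ) = colLabel F p.1.2) :
    tabState n F (levelFilling F t) k p = 1 ↔ CellOne k (t u) (t v) := by
  induction k generalizing p u v with
  | zero =>
    simp only [tabState]
    rw [levelFilling_apply hu hv]
    have hv0 : t v ≠ 0 := fun h => by
      have h1 := (labels_mem hF hu hv).2.2
      rw [ht.eq_zero_iff.1 h] at h1
      exact absurd h1 (Fin.not_lt_zero _)
    by_cases hp : p.1.1 = 0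
    · rw [hp, rowLabel_zero] at hu
      have hu0 := ht.eq_zero_iff.2 (Fin.ext hu : u = 0)
      simp [hp, CellOne, hu0, hv0]
    · have hu0 : t u ≠ 0 := fun h => by
        rw [ht.eq_zero_iff.1 h, Fin.val_zero, ← rowLabel_zero (F := F)] at hu
        exact hp (rowLabel_injective hu).symm
      rw [if_neg hp]
      unfold CellOne
      split_ifs with h
      · simp only [true_iff]
        omega
      · simp only [zero_ne_one, false_iff]
        omega
  | succ k ih =>
    have hrec := mem_nextRecord hF ht ih
    have h1 := labels_mem hF hu hv
    have h2 := ht.even_of_adj (Or.inl h1 : FAdj (rows n F) u v)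
    have h3 := (ht.even_iff u).2 h1.1
    have hc : (∃ w ∈ nextRecord n F k (tabState n F (levelFilling F t) k),
        (w : ℕ) = colLabel F p.1.2) ↔ t v = k + 1 := by
      refine ⟨?_, fun h => ⟨v, (hrec v).2 h, hv⟩⟩
      rintro ⟨w, hw, hw'⟩
      obtain rfl : w = v := Fin.ext (hw'.trans hv.symm)
      exact (hrec w).1 hw
    have hr : (∃ w ∈ nextRecord n F k (tabState n F (levelFilling F t) k),
        (w : ℕ) = rowLabel F p.1.1) ↔ t u = k + 1 := by
      refine ⟨?_, fun h => ⟨u, (hrec u).2 h, hu⟩⟩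
      rintro ⟨w, hw, hw'⟩
      obtain rfl : w = u := Fin.ext (hw'.trans hu.symm)
      exact (hrec w).1 hw
    have h4 := ih p u v hu hv
    have h5 : t u ≠ t v := fun h => by
      rw [h] at h2
      tauto
    rw [tabState]
    simp only [hc, hr]
    unfold CellOne at h4 ⊢
    split_ifs with hk hv' hu'
    · simp only [true_iff]
      omega
    · rw [h4]
      have : t u ≠ k + 1 := fun h => by
        rw [h] at h3
        grind
      omega
    · simp only [zero_ne_one, false_iff]
      omega
    · rw [h4]
      have : t v ≠ k + 1 := fun h => by
        rw [h] at h2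
        grind
      omega

theorem mem_tabCanonTop {k : ℕ} {v : Fin (n + 1)} :
    v ∈ tabCanonTop n F (levelFilling F t) k ↔ t v = k := by
  cases k with
  | zero => rw [tabCanonTop, Finset.mem_singleton, ht.eq_zero_iff]
  | succ k => exact mem_nextRecord hF ht (tabState_levelFilling hF ht k) v

end Level

end

/-! ### The level function of an EW-tableau -/

/-- The height of an element for a well-founded relation on a finite type. -/
theorem exists_height {α : Type*} [Fintype α] {r : α → α → Prop} (hr : WellFounded r) :
    ∃ t : α → ℕ, (∀ u v, r u v → t u < t v) ∧ ∀ v, t v ≠ 0 → ∃ u, r u v ∧ t u + 1 = t v := by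
  let t : α → ℕ := hr.fix fun v ih => Finset.univ.sup fun u => if h : r u v then ih u h + 1 else 0
  have ht : ∀ v, t v = Finset.univ.sup fun u => if r u v then t u + 1 else 0 := by
    intro v
    simp only [t]
    rw [hr.fix_eq]
    simp only [dite_eq_ite]
  refine ⟨t, fun u v h => ?_, fun v hv => ?_⟩
  · have h1 := Finset.le_sup (f := fun u => if r u v then t u + 1 else 0) (Finset.mem_univ u)
    rw [← ht v] at h1
    simp only [if_pos h] at h1
    omega
  · obtain ⟨u, -, hu⟩ := Finset.exists_mem_eq_sup Finset.univ ⟨v, Finset.mem_univ v⟩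
      fun u => if r u v then t u + 1 else 0
    rw [← ht v] at hu
    split_ifs at hu with h
    · exact ⟨u, h, hu.symm⟩
    · exact absurd hu hv

/-- The cell in row `u` and column `v` exists and has entry `a`. -/
def HasEntry {F : YoungDiagram} (T : Filling F) (a : Fin 2) (u v : Fin (n + 1)) : Prop :=
  ∃ p : {p : ℕ × ℕ // p ∈ F}, T p = a ∧ (u : ℕ) = rowLabel F p.1.1 ∧ (v : ℕ) = colLabel F p.1.2

/-- The orientation of the Ferrers graph given by a filling: edges with entry 1 point from the row
to the column, those with entry 0 from the column to the row. -/
def Prec {F : YoungDiagram} (T : Filling F) (u v : Fin (n + 1)) : Prop :=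
  HasEntry T 1 u v ∨ HasEntry T 0 v u

section

variable {F : YoungDiagram} (hF : semiperimeter F = n + 1) {T : Filling F}
include hF

theorem HasEntry.mem {a : Fin 2} {u v : Fin (n + 1)} (h : HasEntry T a u v) :
    u ∈ rows n F ∧ v ∉ rows n F ∧ u < v := by
  obtain ⟨p, -, hu, hv⟩ := h
  exact labels_mem hF hu hv

omit hF in
theorem HasEntry.unique {a b : Fin 2} {u v : Fin (n + 1)} (h : HasEntry T a u v)
    (h' : HasEntry T b u v) : a = b := by
  obtain ⟨p, hp, hu, hv⟩ := h
  obtain ⟨q, hq, hu', hv'⟩ := h'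
  obtain rfl : p = q := Subtype.ext (Prod.ext (rowLabel_injective (hu.symm.trans hu'))
    (colLabel_inj (col_lt_of_mem p.2) (col_lt_of_mem q.2) (hv.symm.trans hv')))
  exact hp.symm.trans hq

theorem hasEntry_or {u v : Fin (n + 1)} (hu : u ∈ rows n F) (hv : v ∉ rows n F) (h : u < v) :
    HasEntry T 0 u v ∨ HasEntry T 1 u v := by
  obtain ⟨p, hp⟩ := exists_cell hF hu hv h
  exact (fin_two_eq (T p)).imp (fun h => ⟨p, h, hp⟩) fun h => ⟨p, h, hp⟩

theorem Prec.mem_iff {u v : Fin (n + 1)} (h : Prec T u v) : u ∈ rows n F ↔ v ∉ rows n F := by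
  rcases h with h | h
  · simp [(h.mem hF).1, (h.mem hF).2.1]
  · simp [(h.mem hF).1, (h.mem hF).2.1]

variable (hT : IsEWTableau F T)
include hT

omit hF in
theorem IsEWTableau.no_rectangle {u u' v v' : Fin (n + 1)} (h1 : HasEntry T 0 u v)
    (h2 : HasEntry T 0 u' v') (h3 : HasEntry T 1 u v') (h4 : HasEntry T 1 u' v) : False := by
  have huu : u ≠ u' := by
    rintro rfl
    exact absurd (h1.unique h4) (by decide)
  have hvv : v ≠ v' := by
    rintro rfl
    exact absurd (h1.unique h3) (by decide)
  obtain ⟨⟨⟨i, j⟩, hp1⟩, e1, hu1, hv1⟩ := h1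
  obtain ⟨⟨⟨i', j'⟩, hp2⟩, e2, hu2, hv2⟩ := h2
  obtain ⟨⟨⟨k, l⟩, hp3⟩, e3, hu3, hv3⟩ := h3
  obtain ⟨⟨⟨k', l'⟩, hp4⟩, e4, hu4, hv4⟩ := h4
  dsimp only at hu1 hv1 hu2 hv2 hu3 hv3 hu4 hv4
  obtain rfl : k = i := rowLabel_injective (hu3.symm.trans hu1)
  obtain rfl : k' = i' := rowLabel_injective (hu4.symm.trans hu2)
  obtain rfl : l = j' := colLabel_inj (col_lt_of_mem hp3) (col_lt_of_mem hp2) (hv3.symm.trans hv2)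
  obtain rfl : l' = j := colLabel_inj (col_lt_of_mem hp4) (col_lt_of_mem hp1) (hv4.symm.trans hv1)
  refine hT.rectangle k k' l' l hp1 hp2 hp3 hp4 ?_ ?_ ⟨e1, e2, e3, e4⟩
  · rintro rfl
    exact huu (Fin.ext (hu1.trans hu2.symm))
  · rintro rfl
    exact hvv (Fin.ext (hv1.trans hv2.symm))

/-- The orientation given by an EW-tableau is acyclic: every nonempty set `S` of vertices has a
source. The columns adjacent to the last row `r` in `S` are adjacent to all rows in `S`, so if `s`
is a source of `S` without `r` that has `r` as a predecessor, the rectangle condition shows that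
every predecessor of `r` is a source of `S`. -/
theorem IsEWTableau.exists_source (S : Finset (Fin (n + 1))) (hS : S.Nonempty) :
    ∃ s ∈ S, ∀ u ∈ S, ¬ Prec T u s := by
  induction S using Finset.strongInduction with
  | H S ih =>
    by_cases hR : (S.filter (· ∈ rows n F)).Nonempty
    · obtain ⟨r, hr, hmax⟩ := Finset.exists_max_image _ id hR
      rw [Finset.mem_filter] at hr
      by_cases hsrc : ∀ u ∈ S, ¬ Prec T u r
      · exact ⟨r, hr.1, hsrc⟩
      · push Not at hsrc
        obtain ⟨v, hvS, hv⟩ := hsrc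
        have hv : HasEntry T 0 r v := hv.resolve_left fun h => (h.mem hF).2.1 hr.2
        have hvr : v ≠ r := fun h => (hv.mem hF).2.1 (h ▸ hr.2)
        obtain ⟨s, hs, hsrc⟩ := ih (S.erase r) (Finset.erase_ssubset hr.1)
          ⟨v, Finset.mem_erase.2 ⟨hvr, hvS⟩⟩
        have hsS := Finset.mem_of_mem_erase hs
        by_cases hrs : Prec T r s
        · have hrs : HasEntry T 1 r s := hrs.resolve_right fun h => (h.mem hF).2.1 hr.2
          refine ⟨v, hvS, fun u huS hu => ?_⟩
          have hu : HasEntry T 1 u v := hu.resolve_right fun h => (hv.mem hF).2.1 (h.mem hF).1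
          have hur : u ≠ r := by
            rintro rfl
            exact absurd (hu.unique hv) (by decide)
          have hule : u ≤ r := hmax u (Finset.mem_filter.2 ⟨huS, (hu.mem hF).1⟩)
          have hus := hsrc u (Finset.mem_erase.2 ⟨hur, huS⟩)
          have hus' : HasEntry T 0 u s :=
            (hasEntry_or hF (hu.mem hF).1 (hrs.mem hF).2.1
              (hule.trans_lt (hrs.mem hF).2.2)).resolve_right fun h => hus (Or.inl h)
          exact hT.no_rectangle hus' hv hu hrs
        · refine ⟨s, hsS, fun u hu => ?_⟩
          by_cases hur : u = r
          · exact hur ▸ hrs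
          · exact hsrc u (Finset.mem_erase.2 ⟨hur, hu⟩)
    · rw [Finset.not_nonempty_iff_eq_empty, Finset.filter_eq_empty_iff] at hR
      obtain ⟨s, hs⟩ := hS
      refine ⟨s, hs, fun u hu h => ?_⟩
      rcases h with h | h
      · exact hR hu (h.mem hF).1
      · exact hR hs (h.mem hF).1

theorem IsEWTableau.wellFounded_prec : WellFounded (Prec T : Fin (n + 1) → Fin (n + 1) → Prop) := by
  rw [WellFounded.wellFounded_iff_has_min]
  rintro s ⟨v, hv⟩
  obtain ⟨m, hm, hmin⟩ := hT.exists_source hF (Finset.univ.filter (· ∈ s)) ⟨v, by simpa using hv⟩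
  exact ⟨m, by simpa using hm, fun x hx => hmin x (by simpa using hx)⟩

theorem IsEWTableau.exists_isLevel (hn : 1 ≤ n) :
    ∃ t : Fin (n + 1) → ℕ, IsLevel (rows n F) t ∧ T = levelFilling F t := by
  have hwf := hT.wellFounded_prec hF
  obtain ⟨t, hlt, hex⟩ := exists_height hwf
  have h0 := zero_mem_rows hF hn
  have htop : ∀ v ∉ rows n F, HasEntry T 1 0 v := by
    intro v hv
    obtain ⟨p, hu, hv'⟩ := exists_cell hF h0 hv (Fin.pos_of_ne_zero fun h => hv (h ▸ h0))
    refine ⟨p, ?_, hu, hv'⟩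
    obtain ⟨⟨i, j⟩, hp⟩ := p
    rw [Fin.val_zero, ← rowLabel_zero (F := F)] at hu
    obtain rfl : 0 = i := rowLabel_injective hu
    exact hT.top_row j hp
  have hpos : ∀ v ≠ 0, t v ≠ 0 := by
    intro v hv
    by_cases hvR : v ∈ rows n F
    · obtain ⟨i, hi, hvi⟩ := exists_row hvR
      have hi0 : i ≠ 0 := by
        rintro rfl
        rw [rowLabel_zero] at hvi
        exact hv (Fin.ext hvi)
      obtain ⟨j, hm, hj⟩ := hT.other_rows i (Nat.pos_of_ne_zero hi0) hi
      have := hlt ⟨_, colLabel_le hF (col_lt_of_mem hm)⟩ v (Or.inr ⟨⟨(i, j), hm⟩, hj, hvi, rfl⟩)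
      omega
    · have := hlt 0 v (Or.inl (htop v hvR))
      omega
  have hzero : t 0 = 0 := by
    by_contra h
    obtain ⟨u, hu, -⟩ := hex 0 h
    rcases hu with hu | hu
    · exact (hu.mem hF).2.1 h0
    · exact absurd (hu.unique (htop u (hu.mem hF).2.1)) (by decide)
  refine ⟨t, ⟨hzero, fun v => ?_, fun v hv => ?_⟩, ?_⟩
  · induction v using hwf.induction with
    | _ v ih =>
      by_cases hv : v = 0
      · simp [hv, hzero, h0]
      · obtain ⟨u, hu, huv⟩ := hex v (hpos v hv)
        have h1 := ih u hu
        have h2 := hu.mem_iff hF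
        rw [← huv]
        grind
  · obtain ⟨u, hu, huv⟩ := hex v (hpos v hv)
    refine ⟨u, ?_, huv⟩
    rcases hu with hu | hu
    · exact Or.inl (hu.mem hF)
    · exact Or.inr (hu.mem hF)
  · funext p
    obtain ⟨u, v, hu, hv⟩ := exists_labels hF p
    rw [levelFilling_apply hu hv]
    rcases fin_two_eq (T p) with h | h
    · have := hlt v u (Or.inr ⟨p, h, hu, hv⟩)
      rw [h, if_neg (by omega)]
    · have := hlt u v (Or.inl ⟨p, h, hu, hv⟩)
      rw [h, if_pos this]

end

/-! ### Run decompositions and level functions -/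

/-- The letter in position `p` of the word `0, w_1, w_2, …`. -/
def letter (w : List (Fin (n + 1))) (p : ℕ) : Fin (n + 1) := (0 :: w).getD p 0

/-- The order in which a level function lists the vertices: by level, the even levels decreasingly
and the odd ones increasingly. -/
def Before (t : Fin (n + 1) → ℕ) (u v : Fin (n + 1)) : Prop :=
  t u < t v ∨ (t u = t v ∧ if Even (t u) then v < u else u < v)

theorem Before.trans {t : Fin (n + 1) → ℕ} {u v w : Fin (n + 1)} (h : Before t u v)
    (h' : Before t v w) : Before t u w := by
  unfold Before at *
  rcases h with h | ⟨h1, h2⟩ <;> rcases h' with h' | ⟨h1', h2'⟩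
  · exact Or.inl (h.trans h')
  · exact Or.inl (h1' ▸ h)
  · exact Or.inl (h1 ▸ h')
  · refine Or.inr ⟨h1.trans h1', ?_⟩
    rw [← h1] at h2'
    split_ifs at h2 h2' ⊢
    · exact h2'.trans h2
    · exact h2.trans h2'

theorem Before.irrefl {t : Fin (n + 1) → ℕ} {u : Fin (n + 1)} : ¬ Before t u u := by
  unfold Before
  simp

namespace IsPermutation

variable {w : List (Fin (n + 1))} (hw : IsPermutation w)
include hw

theorem length_eq : w.length = n := by
  have := List.Perm.length_eq hw
  simpa using this

theorem mem_iff {v : Fin (n + 1)} : v ∈ w ↔ v ≠ 0 := by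
  rw [List.Perm.mem_iff hw]
  simp only [List.mem_map, List.mem_finRange, true_and]
  exact Fin.exists_succ_eq

theorem nodup_cons : (0 :: w).Nodup := by
  rw [List.nodup_cons]
  refine ⟨fun h => hw.mem_iff.1 h rfl, ?_⟩
  rw [List.Perm.nodup_iff hw]
  exact (List.nodup_finRange n).map (Fin.succ_injective n)

theorem letter_eq {p : ℕ} (hp : p ≤ n) :
    letter w p = (0 :: w)[p]'(by rw [List.length_cons, hw.length_eq]; omega) :=
  List.getD_eq_getElem _ _ _

theorem exists_letter (v : Fin (n + 1)) : ∃ p ≤ n, letter w p = v := by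
  have hv : v ∈ 0 :: w := by
    rw [List.mem_cons, hw.mem_iff]
    exact em _
  obtain ⟨p, hp, h⟩ := List.mem_iff_getElem.1 hv
  rw [List.length_cons, hw.length_eq] at hp
  exact ⟨p, by omega, (hw.letter_eq (by omega)).trans h⟩

theorem letter_inj {p q : ℕ} (hp : p ≤ n) (hq : q ≤ n) (h : letter w p = letter w q) : p = q := by
  rw [hw.letter_eq hp, hw.letter_eq hq] at h
  exact (hw.nodup_cons.getElem_inj_iff).1 h

omit hw in
theorem letter_zero : letter w 0 = 0 := rfl

theorem exists_letter_succ {v : Fin (n + 1)} (hv : v ≠ 0) : ∃ p < n, letter w (p + 1) = v := by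
  obtain ⟨p, hp, rfl⟩ := hw.exists_letter v
  cases p with
  | zero => exact absurd letter_zero hv
  | succ p => exact ⟨p, hp, rfl⟩

theorem letter_mem_descentBottoms {p : ℕ} (hp : p < n) :
    letter w (p + 1) ∈ descentBottoms w ↔ letter w (p + 1) < letter w p := by
  unfold descentBottoms
  rw [Finset.mem_filter]
  simp only [Finset.mem_univ, true_and]
  constructor
  · rintro ⟨u, hlt, s, s', hs⟩
    have hlen := congrArg List.length hs
    rw [hw.length_eq] at hlen
    simp only [List.length_append, List.length_cons, List.length_nil] at hlen
    have hu : letter w (s.length + 1) = u := by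
      rw [letter, ← hs]
      simp
    generalize hv : letter w (p + 1) = v at hs hlt
    have hv' : letter w (s.length + 2) = v := by
      rw [letter, ← hs]
      simp
    have hp' := hw.letter_inj (by omega) (by omega) (hv'.trans hv.symm)
    obtain rfl : s.length + 1 = p := by omega
    rwa [hu]
  · intro h
    refine ⟨letter w p, h, ?_⟩
    cases p with
    | zero => exact absurd h (Fin.not_lt_zero _)
    | succ p =>
      have hl := hw.length_eq
      refine ⟨w.take p, w.drop (p + 2), ?_⟩
      rw [hw.letter_eq hp.le, hw.letter_eq hp]
      simp only [List.getElem_cons_succ, List.append_assoc, List.cons_append, List.nil_append]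
      rw [← List.drop_eq_getElem_cons, ← List.drop_eq_getElem_cons, List.take_append_drop]

theorem zero_notMem_descentBottoms : 0 ∉ descentBottoms w := by
  unfold descentBottoms
  rw [Finset.mem_filter]
  rintro ⟨-, u, -, h⟩
  exact hw.mem_iff.1 (h.subset (by simp)) rfl

end IsPermutation

theorem last_notMem_descentBottoms {w : List (Fin (n + 1))} :
    Fin.last n ∉ descentBottoms w := by
  unfold descentBottoms
  rw [Finset.mem_filter]
  rintro ⟨-, u, h, -⟩
  exact absurd h (Fin.le_last u).not_gt

theorem runIndex_succ (w : List (Fin (n + 1))) (p : ℕ) : runIndex w (p + 1) =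
    if (if Even (runIndex w p) then letter w (p + 1) < letter w p
      else letter w p < letter w (p + 1)) then runIndex w p else runIndex w p + 1 := rfl

/-- `t` is a level function, and `0 :: w` lists the labels in the order that it gives. -/
structure Lists (R : Finset (Fin (n + 1))) (t : Fin (n + 1) → ℕ) (w : List (Fin (n + 1))) :
    Prop where
  level : IsLevel R t
  perm : IsPermutation w
  before : (0 :: w).Pairwise (Before t)

namespace Lists

variable {R : Finset (Fin (n + 1))} {t : Fin (n + 1) → ℕ} {w : List (Fin (n + 1))}
  (h : Lists R t w)
include h

theorem before_letter {p q : ℕ} (hpq : p < q) (hq : q ≤ n) :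
    Before t (letter w p) (letter w q) := by
  rw [h.perm.letter_eq hq, h.perm.letter_eq (by omega)]
  exact List.pairwise_iff_getElem.1 h.before _ _ _ _ hpq

/-- Consecutive letters `u`, `v` are on the same level or on consecutive ones. In the latter case
`v` has a neighbour on the level of `u`, and `u` is the last letter of that level, which makes it a
neighbour of `v` as well. -/
theorem step {p : ℕ} (hp : p < n) :
    (t (letter w (p + 1)) = t (letter w p) ∧
      if Even (t (letter w p)) then letter w (p + 1) < letter w p
      else letter w p < letter w (p + 1)) ∨
    (t (letter w (p + 1)) = t (letter w p) + 1 ∧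
      if Even (t (letter w p)) then letter w p < letter w (p + 1)
      else letter w (p + 1) < letter w p) := by
  rcases h.before_letter (Nat.lt_add_one p) hp with hlt | ⟨heq, hlt⟩
  · refine Or.inr ?_
    have hv : letter w (p + 1) ≠ 0 := fun h0 => by
      rw [h0, h.level.zero] at hlt
      omega
    obtain ⟨z, hz, hzt⟩ := h.level.prev _ hv
    obtain ⟨q, hq, rfl⟩ := h.perm.exists_letter z
    have hqp : q ≤ p := by
      by_contra hqp
      rcases Nat.lt_or_ge (p + 1) q with h1 | h1
      · have := h.before_letter h1 hq
        unfold Before at this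
        omega
      · obtain rfl : q = p + 1 := by omega
        omega
    have hle : t (letter w q) = t (letter w p) ∧
        (if Even (t (letter w p)) then letter w p ≤ letter w q else letter w q ≤ letter w p) := by
      rcases Nat.lt_or_ge q p with h1 | h1
      · rcases h.before_letter h1 hp.le with h2 | ⟨h2, h3⟩
        · omega
        · rw [h2] at h3
          refine ⟨h2, ?_⟩
          split_ifs at h3 ⊢ <;> exact h3.le
      · obtain rfl : q = p := by omega
        simp
    refine ⟨by omega, ?_⟩
    have heq := h.level.even_iff (letter w q)
    rw [hle.1] at heq
    split_ifs with hev
    · have h1 := hle.2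
      rw [if_pos hev] at h1
      rcases hz with h2 | h2
      · exact h1.trans_lt h2.2.2
      · exact absurd (heq.1 hev) h2.2.1
    · have h1 := hle.2
      rw [if_neg hev] at h1
      rcases hz with h2 | h2
      · exact absurd (heq.2 h2.1) hev
      · exact h2.2.2.trans_le h1
  · exact Or.inl ⟨heq.symm, hlt⟩

theorem runIndex_eq {p : ℕ} (hp : p ≤ n) : runIndex w p = t (letter w p) := by
  induction p with
  | zero => rw [IsPermutation.letter_zero, h.level.zero, runIndex]
  | succ p ih =>
    rw [runIndex_succ, ih (by omega)]
    rcases h.step hp with ⟨h1, h2⟩ | ⟨h1, h2⟩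
    · rw [if_pos h2, h1]
    · rw [if_neg, h1]
      split_ifs at h2 ⊢ <;> exact h2.not_gt

theorem mem_runBlock {m : ℕ} {v : Fin (n + 1)} : v ∈ runBlock w m ↔ t v = m := by
  unfold runBlock
  simp only [Finset.mem_image, Finset.mem_filter, Finset.mem_range, h.perm.length_eq]
  constructor
  · rintro ⟨p, ⟨hp, hm⟩, rfl⟩
    rw [← hm]
    exact (h.runIndex_eq (by omega)).symm
  · intro hm
    obtain ⟨p, hp, rfl⟩ := h.perm.exists_letter v
    exact ⟨p, ⟨by omega, (h.runIndex_eq hp).trans hm⟩, rfl⟩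

theorem mem_D {l : ℕ} {v : Fin (n + 1)} : v ∈ D w l ↔ t v = 2 * l := h.mem_runBlock

theorem mem_A {l : ℕ} {v : Fin (n + 1)} : v ∈ A w l ↔ t v + 1 = 2 * l := by
  cases l with
  | zero => simp [A]
  | succ l =>
    rw [A, h.mem_runBlock]
    omega

theorem descentBottoms_eq : descentBottoms w = R \ {0} := by
  ext v
  rw [Finset.mem_sdiff, Finset.mem_singleton]
  by_cases hv : v = 0
  · simp [hv, h.perm.zero_notMem_descentBottoms]
  · obtain ⟨p, hp, rfl⟩ := h.perm.exists_letter_succ hv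
    rw [h.perm.letter_mem_descentBottoms hp, ← h.level.even_iff]
    have h1 := h.step hp
    grind

/-- The level function is recovered from the word by the run decomposition. -/
theorem unique {R' : Finset (Fin (n + 1))} {t' : Fin (n + 1) → ℕ} (h' : Lists R' t' w) :
    t = t' := by
  funext v
  obtain ⟨p, hp, rfl⟩ := h.perm.exists_letter v
  rw [← h.runIndex_eq hp, h'.runIndex_eq hp]

theorem word_unique {w' : List (Fin (n + 1))} (h' : Lists R t w') : w = w' := by
  refine List.Perm.eq_of_pairwise (le := Before t) (fun a b _ _ h1 h2 => ?_)
    (List.pairwise_cons.1 h.before).2 (List.pairwise_cons.1 h'.before).2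
    (List.Perm.trans h.perm (List.Perm.symm h'.perm))
  exact absurd (h1.trans h2) Before.irrefl

theorem mu_eq (i : Fin n) : mu w i.succ = slack R t i.succ := by
  unfold mu slack nb
  congr 1
  ext j
  simp only [Finset.mem_filter, Finset.mem_univ, true_and, h.mem_D, h.mem_A]
  have h1 := h.level.even_iff j
  have h2 := h.level.even_iff i.succ
  constructor
  · rintro ⟨l, ⟨h3, h4, h5⟩ | ⟨h3, h4, h5⟩⟩
    · have h6 : i.succ ∈ R := h2.1 (by rw [h3]; exact even_two_mul l)
      have h7 : j ∉ R := fun hj => by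
        have := h1.2 hj
        grind
      exact ⟨Or.inr ⟨h6, h7, h5⟩, by omega⟩
    · have h6 : j ∈ R := h1.1 (by rw [h4]; exact even_two_mul _)
      have h7 : i.succ ∉ R := fun hj => by
        have := h2.2 hj
        grind
      exact ⟨Or.inl ⟨h6, h7, h5⟩, by omega⟩
  · rintro ⟨⟨h3, h4, h5⟩ | ⟨h3, h4, h5⟩, h6⟩
    · obtain ⟨l, hl⟩ := even_iff_two_dvd.1 (h1.2 h3)
      exact ⟨l + 1, Or.inr ⟨by omega, by simpa using hl, h5⟩⟩
    · obtain ⟨l, hl⟩ := even_iff_two_dvd.1 (h2.2 h3)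
      exact ⟨l, Or.inl ⟨hl, by omega, h5⟩⟩

/-- The bound `μ` implies those that define decorated permutations. -/
theorem isCanonical_iff {a : Fin n → ℤ} :
    IsCanonical w a ↔ ∀ i, 0 ≤ a i ∧ a i < slack R t i.succ := by
  constructor
  · rintro ⟨⟨-, hd⟩, hc⟩ i
    refine ⟨?_, h.mu_eq i ▸ hc i⟩
    rcases Nat.even_or_odd' (t i.succ) with ⟨l, hl | hl⟩
    · exact ((hd i l).1 (h.mem_D.2 hl)).1
    · exact ((hd i (l + 1)).2 (h.mem_A.2 (by omega))).1
  · intro ha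
    refine ⟨⟨h.perm, fun i l => ⟨fun hi => ⟨(ha i).1, (ha i).2.trans_le ?_⟩,
      fun hi => ⟨(ha i).1, (ha i).2.trans_le ?_⟩⟩⟩, fun i => ?_⟩
    · rw [h.mem_D] at hi
      unfold slack nb
      rw [Nat.cast_le]
      refine Finset.card_le_card fun j hj => ?_
      simp only [Finset.mem_filter, Finset.mem_univ, true_and] at hj ⊢
      refine ⟨?_, l, le_rfl, h.mem_A.2 (by omega)⟩
      rcases hj.1 with h1 | h1
      · exact absurd ((h.level.even_iff _).1 (by rw [hi]; exact even_two_mul l)) h1.2.1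
      · exact h1.2.2
    · rw [h.mem_A] at hi
      unfold slack nb
      rw [Nat.cast_le]
      refine Finset.card_le_card fun j hj => ?_
      simp only [Finset.mem_filter, Finset.mem_univ, true_and] at hj ⊢
      refine ⟨?_, l - 1, by omega, h.mem_D.2 (by omega)⟩
      rcases hj.1 with h1 | h1
      · exact h1.2.2
      · have := (h.level.even_iff _).2 h1.1
        grind
    · rw [h.mu_eq]
      exact (ha i).2

end Lists

/-- The run decomposition of a permutation is the list of levels of a level function, for the set of
rows that consists of `0` and the descent bottoms. -/
theorem IsPermutation.exists_lists {w : List (Fin (n + 1))} (hw : IsPermutation w) :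
    ∃ t, Lists (insert 0 (descentBottoms w)) t w := by
  let t : Fin (n + 1) → ℕ := fun v => runIndex w ((0 :: w).idxOf v)
  have ht : ∀ p ≤ n, t (letter w p) = runIndex w p := by
    intro p hp
    simp only [t]
    rw [hw.letter_eq hp, hw.nodup_cons.idxOf_getElem]
  have hne : ∀ p < n, letter w (p + 1) ≠ letter w p := by
    intro p hp h
    have := hw.letter_inj hp hp.le h
    omega
  have hstep : ∀ p < n,
      (runIndex w (p + 1) = runIndex w p ∧ if Even (runIndex w p)
        then letter w (p + 1) < letter w p else letter w p < letter w (p + 1)) ∨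
      (runIndex w (p + 1) = runIndex w p + 1 ∧ if Even (runIndex w p)
        then letter w p < letter w (p + 1) else letter w (p + 1) < letter w p) := by
    intro p hp
    have h1 := hne p hp
    rw [runIndex_succ]
    by_cases hev : Even (runIndex w p)
    · simp only [if_pos hev]
      rcases lt_or_gt_of_ne h1 with h2 | h2
      · simp [h2]
      · simp [h2, h2.not_gt]
    · simp only [if_neg hev]
      rcases lt_or_gt_of_ne h1 with h2 | h2
      · simp [h2, h2.not_gt]
      · simp [h2]
  have heven : ∀ p < n, Even (runIndex w (p + 1)) ↔ letter w (p + 1) < letter w p := by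
    intro p hp
    have := hstep p hp
    have := hne p hp
    grind
  -- The last letter of the block before that of position `p + 1` is on the right side of the first
  -- letter of the block, and the block continues in the direction away from it.
  have hprev : ∀ p < n, ∃ q ≤ p, runIndex w q + 1 = runIndex w (p + 1) ∧
      if Even (runIndex w q) then letter w q < letter w (p + 1)
      else letter w (p + 1) < letter w q := by
    intro p
    induction p with
    | zero =>
      intro hp
      refine ⟨0, le_rfl, ?_⟩
      rcases hstep 0 hp with ⟨-, h2⟩ | ⟨h1, h2⟩
      · rw [runIndex, if_pos Even.zero] at h2
        exact absurd h2 (Fin.not_lt_zero _)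
      · exact ⟨h1.symm, h2⟩
    | succ p ih =>
      intro hp
      rcases hstep (p + 1) hp with ⟨h1, h2⟩ | ⟨h1, h2⟩
      · obtain ⟨q, hq, h3, h4⟩ := ih (by omega)
        refine ⟨q, by omega, by omega, ?_⟩
        rw [← h3] at h2
        by_cases hev : Even (runIndex w q)
        · rw [if_neg (by grind)] at h2
          rw [if_pos hev] at h4 ⊢
          exact h4.trans h2
        · rw [if_pos (by grind)] at h2
          rw [if_neg hev] at h4 ⊢
          exact h2.trans h4
      · exact ⟨p + 1, le_rfl, h1.symm, h2⟩
  have hR : ∀ v, Even (t v) ↔ v ∈ insert 0 (descentBottoms w) := by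
    intro v
    rw [Finset.mem_insert]
    by_cases hv : v = 0
    · subst hv
      have := ht 0 (Nat.zero_le _)
      rw [letter_zero] at this
      simp [this, runIndex]
    · obtain ⟨p, hp, rfl⟩ := hw.exists_letter_succ hv
      rw [ht _ hp, heven p hp, hw.letter_mem_descentBottoms hp]
      simp [hv]
  refine ⟨t, ⟨?_, hR, fun v hv => ?_⟩, hw, ?_⟩
  · have := ht 0 (Nat.zero_le _)
    rw [letter_zero] at this
    rw [this, runIndex]
  · obtain ⟨p, hp, rfl⟩ := hw.exists_letter_succ hv
    obtain ⟨q, hq, h1, h2⟩ := hprev p hp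
    refine ⟨letter w q, ?_, by rw [ht _ hp, ht q (by omega), h1]⟩
    have h3 := hR (letter w q)
    have h4 := hR (letter w (p + 1))
    rw [ht q (by omega)] at h3
    rw [ht _ hp, ← h1] at h4
    unfold FAdj
    rw [← h3, ← h4]
    grind
  · have key : ∀ p q, p + 1 ≤ q → q ≤ n → Before t (letter w p) (letter w q) := by
      intro p q hpq
      induction q, hpq using Nat.le_induction with
      | base =>
        intro hp
        unfold Before
        rw [ht _ hp, ht p (by omega)]
        rcases hstep p hp with ⟨h1, h2⟩ | ⟨h1, h2⟩
        · exact Or.inr ⟨h1.symm, h2⟩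
        · exact Or.inl (by omega)
      | succ q hq ih =>
        intro hp
        refine (ih (by omega)).trans ?_
        unfold Before
        rw [ht _ hp, ht q (by omega)]
        rcases hstep q hp with ⟨h1, h2⟩ | ⟨h1, h2⟩
        · exact Or.inr ⟨h1.symm, h2⟩
        · exact Or.inl (by omega)
    rw [List.pairwise_iff_getElem]
    intro p q hp hq hpq
    rw [List.length_cons, hw.length_eq] at hp hq
    rw [← hw.letter_eq (by omega), ← hw.letter_eq (by omega)]
    exact key p q hpq (by omega)

/-- `Ψ` of the filling given by a level function lists the letters in the order given by it. -/
theorem lists_Psi {F : YoungDiagram} (hF : semiperimeter F = n + 1) {t : Fin (n + 1) → ℕ}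
    (ht : IsLevel (rows n F) t) : Lists (rows n F) t (Psi n F (levelFilling F t)) := by
  have hB : ∀ k (v : Fin (n + 1)), v ∈ tabCanonTop n F (levelFilling F t) k ↔ t v = k :=
    fun k v => mem_tabCanonTop hF ht
  have hmem : ∀ k v, v ∈ (if Even k
      then (tabCanonTop n F (levelFilling F t) (k + 1)).sort (· ≤ ·)
      else (tabCanonTop n F (levelFilling F t) (k + 1)).sort (· ≥ ·)) ↔ t v = k + 1 := by
    intro k v
    split_ifs <;> rw [Finset.mem_sort, hB]
  have hpw : (0 :: Psi n F (levelFilling F t)).Pairwise (Before t) := by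
    rw [List.pairwise_cons]
    constructor
    · intro v hv
      obtain ⟨k, -, hv⟩ := List.mem_flatMap.1 hv
      rw [hmem] at hv
      refine Or.inl ?_
      rw [ht.zero]
      omega
    · unfold Psi
      rw [List.pairwise_flatMap]
      constructor
      · intro k _
        split_ifs with hk
        · refine List.Pairwise.imp_of_mem (fun {a b} ha hb hab => ?_)
            (Finset.sortedLT_sort _).pairwise
          rw [Finset.mem_sort, hB] at ha hb
          refine Or.inr ⟨by omega, ?_⟩
          rw [ha, if_neg (by grind)]
          exact hab
        · refine List.Pairwise.imp_of_mem (fun {a b} ha hb hab => ?_)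
            (Finset.sortedGT_sort _).pairwise
          rw [Finset.mem_sort, hB] at ha hb
          refine Or.inr ⟨by omega, ?_⟩
          rw [ha, if_pos (by grind)]
          exact hab
      · refine List.Pairwise.imp (fun {k l} hkl x hx y hy => ?_) List.pairwise_lt_range
        rw [hmem] at hx hy
        exact Or.inl (by omega)
  refine ⟨ht, ?_, hpw⟩
  have hnd : (Psi n F (levelFilling F t)).Nodup :=
    (List.pairwise_cons.1 hpw).2.imp fun {a b} hab => by
      rintro rfl
      exact Before.irrefl hab
  refine (List.perm_ext_iff_of_nodup hnd
    ((List.nodup_finRange n).map (Fin.succ_injective n))).2 fun v => ?_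
  simp only [List.mem_map, List.mem_finRange, true_and]
  rw [Fin.exists_succ_eq, ne_eq, ← ht.eq_zero_iff]
  unfold Psi
  rw [List.mem_flatMap]
  simp only [hmem, List.mem_range]
  have := ht.le v
  constructor
  · rintro ⟨k, -, hk⟩
    omega
  · intro hv
    exact ⟨t v - 1, by omega, by omega⟩

/-! ### Recurrent configurations as decorated level functions -/

section

variable {F : YoungDiagram} (hF : semiperimeter F = n + 1) (hn : 1 ≤ n)
include hF hn

theorem psi_eq {t : Fin (n + 1) → ℕ} (ht : IsLevel (rows n F) t) {x : Config n}
    (hx : Fits (rows n F) t x) :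
    psi F x = (levelFilling F t, fun i => (x i : ℤ) - (lowHeight (rows n F) t i : ℤ)) := by
  rw [psi, minrec_eq hF hn ht hx, phiCT_eq hF ht ht.fits_lowHeight]

theorem exists_psi_eq {t : Fin (n + 1) → ℕ} (ht : IsLevel (rows n F) t) {a : Fin n → ℤ}
    (ha : ∀ i, 0 ≤ a i ∧ a i < slack (rows n F) t i.succ) :
    ∃ x ∈ recurrent (ferrersGraph n F), psi F x = (levelFilling F t, a) := by
  let x : Config n := fun i => lowHeight (rows n F) t i + (a i).toNat
  have hx : Fits (rows n F) t x := fun i => by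
    have := ha i
    simp only [x]
    omega
  refine ⟨x, mem_recurrent_of_fits hF ht hx hn, ?_⟩
  rw [psi_eq hF hn ht hx]
  congr 1
  funext i
  have := ha i
  simp only [x]
  omega

theorem mem_recEW_iff {T : Filling F} (hT : IsEWTableau F T) (a : Fin n → ℤ) :
    (T, a) ∈ recEW n F ↔ IsCanonical (Psi n F T) a := by
  constructor
  · rintro ⟨x, hx, hxT⟩
    obtain ⟨t, ht, hfit⟩ := exists_isLevel_of_mem_recurrent hF hn hx
    rw [psi_eq hF hn ht hfit, Prod.mk.injEq] at hxT
    obtain ⟨rfl, rfl⟩ := hxT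
    rw [(lists_Psi hF ht).isCanonical_iff]
    intro i
    have := hfit i
    omega
  · obtain ⟨t, ht, rfl⟩ := hT.exists_isLevel hF hn
    rw [(lists_Psi hF ht).isCanonical_iff]
    exact exists_psi_eq hF hn ht

theorem bijOn_toDecPerm : Set.BijOn (toDecPerm F) (recurrent (ferrersGraph n F))
    {q | IsCanonical q.1 q.2 ∧ descentBottoms q.1 = rows n F \ {0}} := by
  refine ⟨fun x hx => ?_, fun x hx y hy hxy => ?_, ?_⟩
  · obtain ⟨t, ht, hfit⟩ := exists_isLevel_of_mem_recurrent hF hn hx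
    have hl := lists_Psi hF ht
    rw [Set.mem_ofPred_eq, toDecPerm, psi_eq hF hn ht hfit, hl.isCanonical_iff]
    refine ⟨fun i => ?_, hl.descentBottoms_eq⟩
    have := hfit i
    dsimp only
    omega
  · obtain ⟨t, ht, hfit⟩ := exists_isLevel_of_mem_recurrent hF hn hx
    obtain ⟨s, hs, hfit'⟩ := exists_isLevel_of_mem_recurrent hF hn hy
    rw [toDecPerm, toDecPerm, psi_eq hF hn ht hfit, psi_eq hF hn hs hfit', Prod.mk.injEq] at hxy
    obtain ⟨hw, ha⟩ := hxy
    have hl := lists_Psi hF hs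
    dsimp only at hw
    rw [← hw] at hl
    obtain rfl := (lists_Psi hF ht).unique hl
    funext i
    have := congrFun ha i
    dsimp only at this
    omega
  · rintro ⟨w, a⟩ ⟨hc, hd⟩
    obtain ⟨t, hl⟩ := hc.1.1.exists_lists
    dsimp only at hc hd hl
    have hR : insert 0 (descentBottoms w) = rows n F := by
      rw [hd, Finset.sdiff_singleton_eq_erase, Finset.insert_erase (zero_mem_rows hF hn)]
    rw [hR] at hl
    obtain ⟨x, hx, hpsi⟩ := exists_psi_eq hF hn hl.level (hl.isCanonical_iff.1 hc)
    refine ⟨x, hx, ?_⟩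
    rw [toDecPerm, hpsi, (lists_Psi hF hl.level).word_unique hl]

end

end

end EW

theorem mainTheorem2 (n : ℕ) (hn : 1 ≤ n) :
    (∀ F : YoungDiagram, EW.semiperimeter F = n + 1 →
      (∀ T : EW.Filling F, EW.IsEWTableau F T → ∀ a : Fin n → ℤ,
        (T, a) ∈ EW.recEW n F ↔ EW.IsCanonical (EW.Psi n F T) a) ∧
      Set.BijOn (EW.toDecPerm F) (EW.recurrent (EW.ferrersGraph n F))
        {q | EW.IsCanonical q.1 q.2 ∧ EW.descentBottoms q.1 = EW.rows n F \ {0}}) ∧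
    Set.BijOn (fun y : YoungDiagram × EW.Config n => EW.toDecPerm y.1 y.2)
      {y | EW.semiperimeter y.1 = n + 1 ∧ y.2 ∈ EW.recurrent (EW.ferrersGraph n y.1)}
      {q | EW.IsCanonical q.1 q.2} := by
  refine ⟨fun F hF => ⟨fun T hT a => EW.mem_recEW_iff hF hn hT a, EW.bijOn_toDecPerm hF hn⟩, ?_⟩
  refine ⟨?_, ?_, ?_⟩
  · rintro ⟨F, x⟩ ⟨hF, hx⟩
    exact ((EW.bijOn_toDecPerm hF hn).mapsTo hx).1
  · rintro ⟨F, x⟩ ⟨hF, hx⟩ ⟨F', x'⟩ ⟨hF', hx'⟩ h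
    dsimp only at hF hx hF' hx' h
    have hd := ((EW.bijOn_toDecPerm hF hn).mapsTo hx).2
    rw [h, ((EW.bijOn_toDecPerm hF' hn).mapsTo hx').2] at hd
    have hR : EW.rows n F = EW.rows n F' := by
      rw [← Finset.insert_erase (EW.zero_mem_rows hF hn),
        ← Finset.insert_erase (EW.zero_mem_rows hF' hn), ← Finset.sdiff_singleton_eq_erase,
        ← Finset.sdiff_singleton_eq_erase, hd]
    obtain rfl := EW.rows_injective hF hF' hR
    rw [(EW.bijOn_toDecPerm hF hn).injOn hx hx' h]
  · rintro ⟨w, a⟩ hc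
    have hw : EW.IsPermutation w := hc.1.1
    obtain ⟨F, hF, hR⟩ := EW.exists_rows_eq (Finset.mem_insert_self 0 (EW.descentBottoms w))
      (by
        rw [Finset.mem_insert, not_or]
        refine ⟨fun h => ?_, EW.last_notMem_descentBottoms⟩
        have := congrArg Fin.val h
        simp only [Fin.val_last, Fin.val_zero] at this
        omega)
    obtain ⟨x, hx, hxw⟩ := (EW.bijOn_toDecPerm hF hn).surjOn
      (show (w, a) ∈ {q : List (Fin (n + 1)) × (Fin n → ℤ) | EW.IsCanonical q.1 q.2 ∧
        EW.descentBottoms q.1 = EW.rows n F \ {0}} from ⟨hc, by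
          rw [hR, Finset.sdiff_singleton_eq_erase,
            Finset.erase_insert hw.zero_notMem_descentBottoms]⟩)
    exact ⟨(F, x), ⟨hF, hx⟩, hxw⟩
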